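/- Let $2^{\mathbb N}$ be the Cantor cube with coordinatewise addition modulo $2$, the product (Haar) measure $\mu$, and the metric $d(x,y)=2^{-n}$ for $x\neq y$, where $n=\min\{i:x(i)\neq y(i)\}$. Let $\mathcal M$ be the family of meager subsets of $2^{\mathbb N}$ and $\mathcal E$ the ideal generated by the $\mu$-null $F_\sigma$ sets, i.e. the family of all subsets of $\mu$-null $F_\sigma$ sets. For $A,B\subseteq 2^{\mathbb N}$ put $A+B=\{a+b:a\in A,\ b\in B\}$. For a metric space $Y$ with completion $Y^\star$, the upper Hausdorff dimension of $Y$ is $$\overline{\dim}_{\mathsf H}Y=\inf\{\dim_{\mathsf H}K: K\text{ is }\sigma\text{-compact},\ Y\subseteq K\subseteq Y^\star\}\qquad(\inf\emptyset=\infty).$$ For a family $\mathcal J\in\{\mathcal M,\mathcal E\}$, a set $X\subseteq 2^{\mathbb N}$ is called $\mathcal J$-additive if $X+J\in\mathcal J$ for every $J\in\mathcal J$, and sharply $\mathcal J$-additive if for every $J\in\mathcal J$ there is a $\sigma$-compact set $F\supseteq X$ in $2^{\mathbb N}$ with $F+J\in\mathcal J$. It is called sharply null if for every $M\in\mathcal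 M$ there is a $\sigma$-compact set $F\supseteq X$ in $2^{\mathbb N}$ with $F+M\neq 2^{\mathbb N}$. Theorem. For any set $X\subseteq 2^{\mathbb N}$, the following are equivalent: (i) $X$ is uhnull, i.e. $\overline{\dim}_{\mathsf H}f(X)=0$ for every uniformly continuous mapping $f$ of the metric space $(X,d)$ into a metric space; (ii) $X$ is $\mathcal M$-additive; (iii) $X$ is $\mathcal E$-additive; (iv) $X$ is sharply $\mathcal M$-additive; (v) $X$ is sharply $\mathcal E$-additive; (vi) $X$ is sharply null. In particular, a subset of $2^{\mathbb N}$ is $\mathcal M$-additive if and only if it is $\mathcal E$-additive. -/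

import Mathlib

open scoped ENNReal Pointwise Topology

universe u v

noncomputable section

/-- The Cantor cube `2^ℕ`. It carries the product topology, the coordinatewise addition
modulo 2 and the product σ-algebra. -/
abbrev Cantor : Type := ℕ → ZMod 2

/-- The least difference metric on the Cantor cube: `dist x y = (1/2)^n` where `n` is the least
index at which `x ≠ y` differ. Its topology is (definitionally) the product topology. -/
instance instMetricSpaceCantor : MetricSpace Cantor := PiNat.metricSpace

namespace Cantor

/-- The Haar measure of the Cantor cube, i.e. the product of the uniform probability measures on
the factors. -/
def haar : MeasureTheory.Measure Cantor :=
  MeasureTheory.Measure.infinitePi fun _ : ℕ => ProbabilityTheory.uniformOn (Set.univ : Set (ZMod 2))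

/-- The ideal of meager sets. -/
def meagerIdeal : Set (Set Cantor) := {A | IsMeagre A}

/-- The ideal generated by the null `F_σ` sets: all subsets of null `F_σ` sets. -/
def nullFsigmaIdeal : Set (Set Cantor) :=
  {A | ∃ C : ℕ → Set Cantor, (∀ n, IsClosed (C n)) ∧ haar (⋃ n, C n) = 0 ∧ A ⊆ ⋃ n, C n}

/-- `X` is `J`-additive: `X + A ∈ J` for every `A ∈ J`. -/
def IsAdditive (J : Set (Set Cantor)) (X : Set Cantor) : Prop :=
  ∀ A ∈ J, X + A ∈ J

/-- `X` is sharply `J`-additive: for every `A ∈ J` there is a σ-compact `F ⊇ X` with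
`F + A ∈ J`. -/
def IsSharplyAdditive (J : Set (Set Cantor)) (X : Set Cantor) : Prop :=
  ∀ A ∈ J, ∃ F : Set Cantor, IsSigmaCompact F ∧ X ⊆ F ∧ F + A ∈ J

/-- `X` is sharply null: for every meager `M` there is a σ-compact `F ⊇ X` such that `F + M` is
not the whole Cantor cube. -/
def IsSharplyNull (X : Set Cantor) : Prop :=
  ∀ M ∈ meagerIdeal, ∃ F : Set Cantor, IsSigmaCompact F ∧ X ⊆ F ∧ F + M ≠ Set.univ

end Cantor

/-- The upper Hausdorff dimension of a metric space `Y`: the infimum of the Hausdorff dimensions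
of the σ-compact sets `K` with `Y ⊆ K ⊆ Y*`, where `Y*` is the completion of `Y`
(it is `∞` if there is no such set). -/
def upperDimH (Y : Type u) [MetricSpace Y] : ℝ≥0∞ :=
  ⨅ (K : Set (UniformSpace.Completion Y)) (_ : IsSigmaCompact K)
    (_ : Set.range ((↑) : Y → UniformSpace.Completion Y) ⊆ K), dimH K

/-- A metric space `X` is uhnull if `f(X)`, as a metric space, has upper Hausdorff dimension zero
for every uniformly continuous mapping `f` of `X` into a metric space `Y`. -/
def IsUHNull (X : Type u) [MetricSpace X] : Prop :=
  ∀ (Y : Type v) [MetricSpace Y] (f : X → Y), UniformContinuous f → upperDimH (Set.range f) = 0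

end

/-! Everything passes through one combinatorial property, `IsGroupCovered`: for every prescribed `f`
there are finite groups of cylinders, the `j`-th one indexed by `n` in `[j, g j)` with lengths `f
n`, such that each point of `X` is caught by all but finitely many groups. Each of the six
conditions either implies this property directly or follows from it.

The points caught by all groups from `m` on form a compact set, and `X` lies in the union of these
sets. If `f` grows fast relative to a given meager or null `F_σ` set, their sums with its closed
pieces stay nowhere dense or null; this gives sharp additivity for both ideals. If `f` is a fast
modulus of continuity, the groups become covers proving dimension zero.

Conversely, sharp nullness is tested on the complement of a limsup of cylinders around a dense
sequence, and being uhnull on a recoding of `X` that turns diameter `1/(n+2)` into agreement below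
`f n`. An additive `X` is tested on one closed set built from consecutive blocks: by Baire, `x` plus
a relatively open piece of it lies in one closed meager or null set. For `𝓜` the points nonzero on
every block suffice, since a translate can be steered into a forbidden pattern unless `x` already
agrees with it on some block. For `𝓔` the closed set is the zero set of quadratic forms: their
translates are pairwise orthogonal as signs, so a second moment bound (`card_mul_haar_le`) shows
that only few `x` prevent steering the translate away from the null set. In both cases the
exceptional `x` lie in boundedly many cylinders, and `isGroupCovered_of_finset` concludes. -/

open MeasureTheory Filter

namespace Cantor

/-! ### Haar measure, cylinders and thickenings -/

instance : IsProbabilityMeasure haar := by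
  unfold haar; infer_instance

lemma uniformOn_map_add (a : ZMod 2) :
    (ProbabilityTheory.uniformOn (Set.univ : Set (ZMod 2))).map (fun x => a + x) =
      ProbabilityTheory.uniformOn Set.univ := by
  ext s hs
  rw [Measure.map_apply (measurable_const_add a) hs, ProbabilityTheory.uniformOn_univ,
    ProbabilityTheory.uniformOn_univ]
  congr 1
  rw [← Measure.map_apply (measurable_const_add a) hs, (measurePreserving_add_left _ a).map_eq]

instance : haar.IsAddLeftInvariant := by
  refine ⟨fun a => ?_⟩
  have h := Measure.infinitePi_map_pi
    (fun _ : ℕ => ProbabilityTheory.uniformOn (Set.univ : Set (ZMod 2)))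
    (f := fun i x => a i + x) (fun i => measurable_const_add (a i))
  simp only [uniformOn_map_add] at h
  exact h

lemma haar_cylinder (x : Cantor) (k : ℕ) : haar (PiNat.cylinder x k) = 2⁻¹ ^ k := by
  have : PiNat.cylinder x k = Set.pi (Finset.range k : Set ℕ) fun i => {x i} := by
    ext y; simp [PiNat.cylinder, Set.pi]
  rw [this, haar, Measure.infinitePi_pi _ (fun i _ => measurableSet_singleton _)]
  simp [ProbabilityTheory.uniformOn_univ, ZMod.card]

lemma haar_real_cylinder (x : Cantor) (k : ℕ) : haar.real (PiNat.cylinder x k) = (1 / 2) ^ k := by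
  simp [Measure.real, haar_cylinder]

/-- The point that agrees with `x` below `k` and with `y` from `k` on. -/
def splice (k : ℕ) (x y : Cantor) : Cantor := fun i => if i < k then x i else y i

lemma splice_of_lt {k i : ℕ} (x y : Cantor) (h : i < k) : splice k x y i = x i := if_pos h

lemma splice_of_le {k i : ℕ} (x y : Cantor) (h : k ≤ i) : splice k x y i = y i := if_neg h.not_gt

/-- A set depending on finitely many coordinates is clopen. -/
lemma isOpen_of_cylinder {S : Set Cantor} (k : ℕ) (h : ∀ x ∈ S, PiNat.cylinder x k ⊆ S) :
    IsOpen S := by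
  rw [isOpen_iff_mem_nhds]
  intro x hx
  exact mem_of_superset ((PiNat.isOpen_cylinder _ x k).mem_nhds (PiNat.self_mem_cylinder x k))
    (h x hx)

lemma isClopen_of_cylinder {S : Set Cantor} (k : ℕ) (h : ∀ x ∈ S, PiNat.cylinder x k ⊆ S) :
    IsClopen S := by
  refine ⟨⟨isOpen_of_cylinder k fun x hx y hy hyS => hx ?_⟩, isOpen_of_cylinder k h⟩
  exact h y hyS ((PiNat.mem_cylinder_comm _ _ _).1 hy)

lemma exists_cylinder_subset {S : Set Cantor} (hS : IsOpen S) {x : Cantor} (hx : x ∈ S) :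
    ∃ k, PiNat.cylinder x k ⊆ S := by
  obtain ⟨v, ⟨y, n, rfl⟩, hxv, hv⟩ :=
    (PiNat.isTopologicalBasis_cylinders (fun _ : ℕ => ZMod 2)).exists_subset_of_mem_open hx hS
  exact ⟨n, (PiNat.mem_cylinder_iff_eq.1 hxv).trans_subset hv⟩

/-- The union of the cylinders of length `k` that meet `C`. -/
def thick (C : Set Cantor) (k : ℕ) : Set Cantor := {z | ∃ c ∈ C, ∀ i < k, z i = c i}

lemma isClopen_thick (C : Set Cantor) (k : ℕ) : IsClopen (thick C k) := by
  refine isClopen_of_cylinder k ?_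
  rintro x ⟨c, hc, h⟩ y hy
  exact ⟨c, hc, fun i hi => (hy i hi).trans (h i hi)⟩

lemma thick_anti (C : Set Cantor) : Antitone (thick C) := by
  rintro k l hkl z ⟨c, hc, h⟩
  exact ⟨c, hc, fun i hi => h i (hi.trans_le hkl)⟩

lemma iInter_thick {C : Set Cantor} (hC : IsClosed C) : ⋂ k, thick C k = C := by
  refine Set.Subset.antisymm (fun z hz => ?_)
    (fun z hz => Set.mem_iInter.2 fun k => ⟨z, hz, fun _ _ => rfl⟩)
  by_contra hzC
  obtain ⟨k, hk⟩ := exists_cylinder_subset hC.isOpen_compl hzC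
  obtain ⟨c, hc, h⟩ := Set.mem_iInter.1 hz k
  exact hk (fun i hi => (h i hi).symm) hc

lemma exists_haar_thick_lt {C : Set Cantor} (hC : IsClosed C) (h0 : haar C = 0) {ε : ℝ≥0∞}
    (hε : 0 < ε) : ∃ k₀, ∀ k ≥ k₀, haar (thick C k) < ε := by
  have h := tendsto_measure_iInter_atTop (μ := haar) (s := thick C)
    (fun k => (isClopen_thick C k).isOpen.measurableSet.nullMeasurableSet) (thick_anti C)
    ⟨0, measure_ne_top _ _⟩
  rw [iInter_thick hC, h0] at h
  exact eventually_atTop.1 (h.eventually_lt_const hε)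

lemma add_self (x : Cantor) : x + x = 0 := by
  ext i; exact CharTwo.add_self_eq_zero _

lemma add_apply_eq_iff {x y z : Cantor} {i : ℕ} : (x + y) i = z i ↔ y i = x i + z i := by
  simp only [Pi.add_apply]
  generalize x i = a; generalize y i = b; generalize z i = c
  revert a b c; decide

open scoped Classical in
/-- Representatives of the cylinders of length `k`. -/
noncomputable def words (k : ℕ) : Finset Cantor :=
  Finset.univ.image fun (w : Fin k → ZMod 2) i => if h : i < k then w ⟨i, h⟩ else 0

lemma card_words_le (k : ℕ) : (words k).card ≤ 2 ^ k := by
  classical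
  exact Finset.card_image_le.trans (by simp [ZMod.card])

lemma splice_zero_mem_words (k : ℕ) (x : Cantor) : splice k x 0 ∈ words k := by
  classical
  refine Finset.mem_image.2 ⟨fun i => x i, Finset.mem_univ _, ?_⟩
  ext i; simp [splice]

lemma exists_blockwise {a : ℕ → ℕ} (ha : StrictMono a) (u : ℕ → Cantor) :
    ∃ z : Cantor, ∀ n i, a n ≤ i → i < a (n + 1) → z i = u n i := by
  -- The block of `i` has index at most `i` because `n ≤ a n`, so the search bound `i` loses
  -- nothing. Coordinates below `a 0` get an irrelevant value.
  refine ⟨fun i => u (Nat.findGreatest (fun n => a n ≤ i) i) i, fun n i h₁ h₂ => ?_⟩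
  have : Nat.findGreatest (fun n => a n ≤ i) i = n := by
    rw [Nat.findGreatest_eq_iff]
    refine ⟨(ha.le_apply).trans h₁, fun _ => h₁, fun m hm _ h => ?_⟩
    exact absurd (ha.monotone (Nat.succ_le_of_lt hm)) (by simp only [Nat.succ_eq_add_one]; omega)
  simp only [this]

/-! ### Group coverings and their compact envelopes -/

/-- `X` is covered by points selected in finite groups, with cylinders of prescribed lengths. -/
def IsGroupCovered (X : Set Cantor) : Prop :=
  ∀ f : ℕ → ℕ, ∃ (g : ℕ → ℕ) (p : ℕ → ℕ → Cantor), ∀ x ∈ X, ∀ᶠ j in atTop,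
    ∃ n, j ≤ n ∧ n < g j ∧ ∀ i < f n, x i = p j n i

/-- The heads `s` are treated one at a time: density of the complement lets the pattern found so far
be prolonged to escape `C` after the new head, and prolonging does not spoil earlier escapes. -/
lemma exists_pattern_finset {C : Set Cantor} (hC : IsClosed C) (hd : interior C = ∅) (k : ℕ)
    (S : Finset Cantor) : ∃ l, k < l ∧ ∃ y : Cantor, ∀ s ∈ S, ∀ z : Cantor,
      (∀ i < k, z i = s i) → (∀ i, k ≤ i → i < l → z i = y i) → z ∉ C := by
  classical
  induction S using Finset.induction_on with
  | empty => exact ⟨k + 1, by omega, 0, by simp⟩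
  | insert s S _ ih =>
    obtain ⟨l, hl, y, hy⟩ := ih
    obtain ⟨y', hy', hyC⟩ := (interior_eq_empty_iff_dense_compl.1 hd).inter_open_nonempty _
      (PiNat.isOpen_cylinder _ (splice k s y) l) ⟨_, PiNat.self_mem_cylinder _ _⟩
    obtain ⟨l', hl'⟩ := exists_cylinder_subset hC.isOpen_compl hyC
    have hy'k : ∀ i < k, y' i = s i := fun i hi =>
      (hy' i (hi.trans hl)).trans (splice_of_lt _ _ hi)
    have hy'l : ∀ i, k ≤ i → i < l → y' i = y i := fun i h₁ h₂ =>
      (hy' i h₂).trans (splice_of_le _ _ h₁)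
    refine ⟨max l l', lt_max_of_lt_left hl, y', fun t ht z h₁ h₂ => ?_⟩
    rcases Finset.mem_insert.1 ht with rfl | ht
    · refine hl' fun i hi => ?_
      rcases lt_or_ge i k with h | h
      · rw [h₁ i h, hy'k i h]
      · exact h₂ i h (lt_max_of_lt_right hi)
    · refine hy t ht z h₁ fun i h h' => ?_
      rw [h₂ i h (lt_max_of_lt_left h'), hy'l i h h']

lemma exists_pattern {C : Set Cantor} (hC : IsClosed C) (hd : interior C = ∅) (k : ℕ) :
    ∃ l, k < l ∧ ∃ y : Cantor, ∀ z : Cantor, (∀ i, k ≤ i → i < l → z i = y i) → z ∉ C := by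
  obtain ⟨l, hl, y, h⟩ := exists_pattern_finset hC hd k (words k)
  exact ⟨l, hl, y, fun z => h _ (splice_zero_mem_words k z) z
    fun i hi => (splice_of_lt _ _ hi).symm⟩

lemma exists_monotone_closed_of_isMeagre {M : Set Cantor} (hM : IsMeagre M) :
    ∃ C : ℕ → Set Cantor, Monotone C ∧ (∀ n, IsClosed (C n)) ∧ (∀ n, interior (C n) = ∅) ∧
      M ⊆ ⋃ n, C n := by
  obtain ⟨S, hS, hc, hMS⟩ := isMeagre_iff_countable_union_isNowhereDense.1 hM
  obtain ⟨φ, hφ⟩ := ((hc.image closure).insert ∅).exists_eq_range (Set.insert_nonempty _ _)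
  have hφc : ∀ n, IsClosed (φ n) ∧ interior (φ n) = ∅ := by
    intro n
    rcases (hφ ▸ Set.mem_range_self n : φ n ∈ insert ∅ (closure '' S)) with h | ⟨t, ht, h⟩
    · simp [h]
    · rw [← h]; exact ⟨isClosed_closure, hS t ht⟩
  have hcl : ∀ n, IsClosed (Set.accumulate φ n) := fun n =>
    (Set.finite_Iic n).isClosed_biUnion fun i _ => (hφc i).1
  refine ⟨Set.accumulate φ, Set.monotone_accumulate, hcl, fun n => ?_, ?_⟩
  · induction n with
    | zero => simpa [Set.accumulate_def] using (hφc 0).2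
    | succ n ih =>
      rw [Set.accumulate_succ, interior_union_isClosed_of_interior_empty (hcl n) (hφc _).2, ih]
  · rw [Set.iUnion_accumulate]
    intro x hx
    obtain ⟨t, ht, hxt⟩ := hMS hx
    obtain ⟨n, hn⟩ : closure t ∈ Set.range φ :=
      hφ ▸ Set.mem_insert_of_mem _ (Set.mem_image_of_mem _ ht)
    exact Set.mem_iUnion.2 ⟨n, hn ▸ subset_closure hxt⟩

lemma exists_monotone_closed_of_nullFsigma {A : Set Cantor} (hA : A ∈ nullFsigmaIdeal) :
    ∃ C : ℕ → Set Cantor, Monotone C ∧ (∀ n, IsClosed (C n)) ∧ (∀ n, haar (C n) = 0) ∧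
      A ⊆ ⋃ n, C n := by
  obtain ⟨C, hcl, h0, hAC⟩ := hA
  have hU : ⋃ n, Set.accumulate C n = ⋃ n, C n := Set.iUnion_accumulate
  exact ⟨Set.accumulate C, Set.monotone_accumulate,
    fun n => (Set.finite_Iic n).isClosed_biUnion fun i _ => hcl i,
    fun n => measure_mono_null ((Set.subset_iUnion _ n).trans hU.subset) h0, hU ▸ hAC⟩

/-- The points captured by the `j`-th group of cylinders. -/
def selected (f g : ℕ → ℕ) (p : ℕ → ℕ → Cantor) (j : ℕ) : Set Cantor :=
  {x | ∃ n, j ≤ n ∧ n < g j ∧ ∀ i < f n, x i = p j n i}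

lemma isClosed_selected (f g : ℕ → ℕ) (p : ℕ → ℕ → Cantor) (j : ℕ) :
    IsClosed (selected f g p j) := by
  refine (isClopen_of_cylinder ((Finset.range (g j)).sup f) ?_).1
  rintro x ⟨n, h₁, h₂, h₃⟩ y hy
  refine ⟨n, h₁, h₂, fun i hi => (hy i ?_).trans (h₃ i hi)⟩
  exact hi.trans_le (Finset.le_sup (f := f) (Finset.mem_range.2 h₂))

/-- The points captured by all groups of index at least `m`. -/
def selectedFrom (f g : ℕ → ℕ) (p : ℕ → ℕ → Cantor) (m : ℕ) : Set Cantor :=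
  ⋂ j ≥ m, selected f g p j

lemma isCompact_selectedFrom (f g : ℕ → ℕ) (p : ℕ → ℕ → Cantor) (m : ℕ) :
    IsCompact (selectedFrom f g p m) :=
  (isClosed_biInter fun j _ => isClosed_selected f g p j).isCompact

lemma selectedFrom_mono (f g : ℕ → ℕ) (p : ℕ → ℕ → Cantor) : Monotone (selectedFrom f g p) :=
  fun _ _ h => Set.biInter_subset_biInter_left fun _ hj => le_trans h hj

lemma subset_iUnion_selectedFrom {X : Set Cantor} {f g : ℕ → ℕ} {p : ℕ → ℕ → Cantor}
    (h : ∀ x ∈ X, ∀ᶠ j in atTop, ∃ n, j ≤ n ∧ n < g j ∧ ∀ i < f n, x i = p j n i) :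
    X ⊆ ⋃ m, selectedFrom f g p m := fun x hx => by
  obtain ⟨m, hm⟩ := eventually_atTop.1 (h x hx)
  exact Set.mem_iUnion.2 ⟨m, Set.mem_iInter₂.2 hm⟩

lemma add_subset_of_monotone {F C : ℕ → Set Cantor} (hF : Monotone F) (hC : Monotone C)
    {A : Set Cantor} (hA : A ⊆ ⋃ n, C n) : (⋃ m, F m) + A ⊆ ⋃ m, F m + C m := by
  rintro _ ⟨x, hx, a, ha, rfl⟩
  obtain ⟨m, hm⟩ := Set.mem_iUnion.1 hx
  obtain ⟨n, hn⟩ := Set.mem_iUnion.1 (hA ha)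
  exact Set.mem_iUnion.2 ⟨max m n, Set.add_mem_add (hF (le_max_left _ _) hm)
    (hC (le_max_right _ _) hn)⟩

lemma selectedFrom_add_subset {C : ℕ → Set Cantor} (hC : Monotone C) (f g : ℕ → ℕ)
    (p : ℕ → ℕ → Cantor) {m j : ℕ} (h : m ≤ j) :
    selectedFrom f g p m + C m ⊆ selected f g p j + C j :=
  Set.add_subset_add (Set.biInter_subset_of_mem h) (hC h)

/-! ### From group coverings to sharp additivity -/

theorem IsGroupCovered.isSharplyAdditive_meager {X : Set Cantor} (hX : IsGroupCovered X) :
    IsSharplyAdditive meagerIdeal X := by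
  intro A hA
  obtain ⟨C, hmono, hcl, hint, hAC⟩ := exists_monotone_closed_of_isMeagre hA
  choose! nxt hnxt t ht using fun n k => exists_pattern (hcl n) (hint n) k
  let a : ℕ → ℕ := fun n => Nat.rec 0 (fun n k => nxt n k) n
  have ha : StrictMono a := strictMono_nat_of_lt_succ fun n => hnxt n (a n)
  obtain ⟨g, p, hgp⟩ := hX fun n => a (n + 1)
  refine ⟨_, isSigmaCompact_iUnion_of_isCompact _ (isCompact_selectedFrom _ g p),
    subset_iUnion_selectedFrom hgp, ?_⟩
  refine IsMeagre.mono (add_subset_of_monotone (selectedFrom_mono _ g p) hmono hAC)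
    (isMeagre_iUnion fun m => ?_)
  have hclosed : IsClosed (selectedFrom (fun n => a (n + 1)) g p m + C m) :=
    ((isCompact_selectedFrom _ g p m).add (hcl m).isCompact).isClosed
  refine IsNowhereDense.isMeagre ?_
  rw [hclosed.isNowhereDense_iff, Set.eq_empty_iff_forall_notMem]
  intro x hx
  obtain ⟨k, hk⟩ := exists_cylinder_subset isOpen_interior hx
  set j := max m k
  -- If `z` were `b + c` with `b` caught by the `n`-th cylinder of group `j`, then `c` would carry
  -- on block `n` the pattern that `C n` omits. Blocks `n ≥ j ≥ k` lie beyond the given cylinder.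
  obtain ⟨z, hz⟩ := exists_blockwise ha fun n => p j n + t n (a n)
  have hmem : splice k x z ∈ selectedFrom (fun n => a (n + 1)) g p m + C m :=
    interior_subset (hk fun i hi => splice_of_lt _ _ hi)
  obtain ⟨b, ⟨n, hjn, -, hb⟩, c, hc, hbc⟩ :=
    selectedFrom_add_subset hmono _ g p (le_max_left m k) hmem
  refine ht n (a n) c (fun i h₁ h₂ => ?_) (hmono hjn hc)
  have hki : k ≤ i := ((le_max_right m k).trans hjn).trans (ha.le_apply.trans h₁)
  have h := congrFun hbc i
  simp only [splice_of_le _ _ hki, hz n i h₁ h₂, Pi.add_apply, hb i h₂] at h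
  exact add_left_cancel h

theorem IsGroupCovered.isSharplyAdditive_nullFsigma {X : Set Cantor} (hX : IsGroupCovered X) :
    IsSharplyAdditive nullFsigmaIdeal X := by
  intro A hA
  obtain ⟨C, hmono, hcl, hC0, hAC⟩ := exists_monotone_closed_of_nullFsigma hA
  have hsmall : ∀ n, ∃ k, haar (thick (C n) k) < 2⁻¹ ^ n := fun n => by
    obtain ⟨k, hk⟩ := exists_haar_thick_lt (hcl n) (hC0 n)
      (ε := 2⁻¹ ^ n) (ENNReal.pow_pos (by simp) n)
    exact ⟨k, hk k le_rfl⟩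
  choose f hf using hsmall
  obtain ⟨g, p, hgp⟩ := hX f
  refine ⟨_, isSigmaCompact_iUnion_of_isCompact _ (isCompact_selectedFrom _ g p),
    subset_iUnion_selectedFrom hgp, fun m => selectedFrom f g p m + C m,
    fun m => ((isCompact_selectedFrom _ g p m).add (hcl m).isCompact).isClosed,
    measure_iUnion_null fun m => ?_,
    add_subset_of_monotone (selectedFrom_mono _ g p) hmono hAC⟩
  -- Each cylinder of group `j` translates a thickening of measure below `2⁻¹ ^ n`; the sum is a
  -- tail of a convergent series, and `j` is arbitrary.
  have hbound : ∀ j, m ≤ j → haar (selectedFrom f g p m + C m) ≤ ∑' n, 2⁻¹ ^ (n + j) := by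
    intro j hj
    have hsub : selectedFrom f g p m + C m ⊆ ⋃ n, p j (n + j) +ᵥ thick (C (n + j)) (f (n + j)) := by
      refine (selectedFrom_add_subset hmono f g p hj).trans ?_
      rintro _ ⟨b, ⟨n, hjn, -, hb⟩, c, hc, rfl⟩
      obtain ⟨n, rfl⟩ := Nat.exists_eq_add_of_le' hjn
      refine Set.mem_iUnion.2 ⟨n, Set.mem_vadd_set.2
        ⟨p j (n + j) + (b + c), ⟨c, hmono hjn hc, fun i hi => ?_⟩, ?_⟩⟩
      · rw [← add_assoc]
        simp [hb i hi, CharTwo.add_self_eq_zero]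
      · simp [← add_assoc, add_self]
    refine (measure_mono hsub).trans ((measure_iUnion_le _).trans (ENNReal.tsum_le_tsum fun n => ?_))
    rw [measure_vadd]
    exact (hf _).le
  have hlim := ENNReal.tendsto_sum_nat_add (fun n => (2⁻¹ : ℝ≥0∞) ^ n) (by simp)
  exact le_antisymm (ge_of_tendsto hlim (eventually_atTop.2 ⟨m, hbound⟩)) bot_le

lemma IsSharplyAdditive.isAdditive_meager {X : Set Cantor}
    (h : IsSharplyAdditive meagerIdeal X) : IsAdditive meagerIdeal X := fun A hA => by
  obtain ⟨F, -, hXF, hF⟩ := h A hA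
  exact IsMeagre.mono (Set.add_subset_add_right hXF) hF

lemma IsSharplyAdditive.isAdditive_nullFsigma {X : Set Cantor}
    (h : IsSharplyAdditive nullFsigmaIdeal X) : IsAdditive nullFsigmaIdeal X := fun A hA => by
  obtain ⟨F, -, hXF, C, hC, h0, hF⟩ := h A hA
  exact ⟨C, hC, h0, (Set.add_subset_add_right hXF).trans hF⟩

lemma IsSharplyAdditive.isSharplyNull {X : Set Cantor}
    (h : IsSharplyAdditive meagerIdeal X) : IsSharplyNull X := fun M hM => by
  obtain ⟨F, hF, hXF, hFM⟩ := h M hM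
  refine ⟨F, hF, hXF, fun hu => ?_⟩
  rw [hu] at hFM
  exact not_isMeagre_of_isOpen isOpen_univ Set.univ_nonempty hFM

/-! ### From sharp nullness and meager-additivity to group coverings -/

theorem IsSharplyNull.isGroupCovered {X : Set Cantor} (hX : IsSharplyNull X) :
    IsGroupCovered X := by
  intro f
  -- Every point of the dense sequence recurs at arbitrarily large indices, so all tail unions `U j`
  -- stay dense.
  let q : ℕ → Cantor := fun n => TopologicalSpace.denseSeq Cantor n.unpair.1
  let U : ℕ → Set Cantor := fun j => ⋃ n ≥ j, PiNat.cylinder (q n) (f n)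
  have hUo : ∀ j, IsOpen (U j) := fun j => isOpen_biUnion fun n _ => PiNat.isOpen_cylinder _ _ _
  have hUd : ∀ j, Dense (U j) := by
    intro j
    refine (TopologicalSpace.denseRange_denseSeq Cantor).mono ?_
    rintro _ ⟨k, rfl⟩
    refine Set.mem_biUnion (x := Nat.pair k j) (Nat.right_le_pair k j) ?_
    simp only [q, Nat.unpair_pair]
    exact PiNat.self_mem_cylinder _ _
  have hM : (⋂ j, U j)ᶜ ∈ meagerIdeal := by
    change (⋂ j, U j)ᶜᶜ ∈ residual Cantor
    rw [compl_compl]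
    exact residual_of_dense_Gδ (.iInter_of_isOpen hUo) (dense_iInter_of_isOpen hUo hUd)
  obtain ⟨F, ⟨K, hKc, rfl⟩, hXF, hne⟩ := hX _ hM
  obtain ⟨z, hz⟩ := (Set.ne_univ_iff_exists_notMem _).1 hne
  -- As the group has exponent 2, `z ∉ F + M` says that `z + F` misses `M`, hence lies in every `U
  -- j`.
  have hKU : ∀ j, Set.accumulate K j ⊆ ⋃ n ≥ j, (fun x => z + x) ⁻¹' PiNat.cylinder (q n) (f n) := by
    intro j x hx
    have hxU : z + x ∈ ⋂ j, U j := by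
      by_contra hcon
      refine hz ⟨x, Set.mem_iUnion.2 ?_, z + x, hcon, ?_⟩
      · obtain ⟨i, -, hi⟩ := Set.mem_accumulate.1 hx
        exact ⟨i, hi⟩
      · simp only []
        rw [add_left_comm, add_self, add_zero]
    obtain ⟨n, hn, h⟩ := Set.mem_iUnion₂.1 (Set.mem_iInter.1 hxU j)
    exact Set.mem_iUnion₂.2 ⟨n, hn, h⟩
  have hfin : ∀ j, ∃ g, ∀ x ∈ Set.accumulate K j,
      ∃ n, j ≤ n ∧ n < g ∧ ∀ i < f n, x i = (z + q n) i := by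
    intro j
    have hcomp : IsCompact (Set.accumulate K j) :=
      (Set.finite_Iic j).isCompact_biUnion fun i _ => hKc i
    obtain ⟨b, hbj, hbf, hb⟩ := hcomp.elim_finite_subcover_image (b := {n | n ≥ j})
      (fun n _ => (PiNat.isOpen_cylinder _ (q n) (f n)).preimage (continuous_const_add z)) (hKU j)
    obtain ⟨N, hN⟩ := hbf.bddAbove
    refine ⟨N + 1, fun x hx => ?_⟩
    obtain ⟨n, hn, h⟩ := Set.mem_iUnion₂.1 (hb hx)
    exact ⟨n, hbj hn, Nat.lt_succ_of_le (hN hn), fun i hi => add_apply_eq_iff.1 (h i hi)⟩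
  choose g hg using hfin
  refine ⟨g, fun _ n => z + q n, fun x hx => ?_⟩
  obtain ⟨m, hm⟩ := Set.mem_iUnion.1 (hXF hx)
  exact eventually_atTop.2 ⟨m, fun j hj => hg j x (Set.mem_accumulate.2 ⟨m, hj, hm⟩)⟩

/-- It suffices to cover `X` by groups of cylinders where the number of cylinders of length
`a (n + 1)` is bounded in terms of `n` and `a n`. -/
lemma isGroupCovered_of_finset (B : ℕ → ℕ → ℕ) {X : Set Cantor}
    (h : ∀ a : ℕ → ℕ, StrictMono a → ∃ (g : ℕ → ℕ) (Q : ℕ → ℕ → Finset Cantor),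
      (∀ j n, (Q j n).card ≤ B n (a n)) ∧ ∀ x ∈ X, ∀ᶠ j in atTop,
        ∃ n, j ≤ n ∧ n < g j ∧ ∃ y ∈ Q j n, ∀ i < a (n + 1), x i = y i) :
    IsGroupCovered X := by
  intro f
  -- The bound at stage `n` involves only `a n`, so `a (n + 1)` can be chosen to dominate `f` at all
  -- codes `Nat.pair n c` of the cylinders of that stage.
  let a : ℕ → ℕ := fun n =>
    Nat.rec 0 (fun n k => k + 1 + (Finset.range (Nat.pair n (B n k))).sup f) n
  have ha1 : ∀ n, a (n + 1) = a n + 1 + (Finset.range (Nat.pair n (B n (a n)))).sup f :=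
    fun n => rfl
  have ha : StrictMono a := strictMono_nat_of_lt_succ fun n => by rw [ha1]; omega
  obtain ⟨g, Q, hQ, hX⟩ := h a ha
  refine ⟨fun j => (Finset.range (g j)).sup (fun n => Nat.pair n (B n (a n))),
    fun j l => (Q j l.unpair.1).toList.getD l.unpair.2 0, fun x hx => (hX x hx).mono ?_⟩
  rintro j ⟨n, hjn, hng, y, hy, hxy⟩
  obtain ⟨c, hc, hcy⟩ := List.getElem_of_mem (Finset.mem_toList.2 hy)
  have hcB : c < B n (a n) := by
    rw [Finset.length_toList] at hc
    exact hc.trans_le (hQ j n)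
  have hlt : Nat.pair n c < Nat.pair n (B n (a n)) := Nat.pair_lt_pair_right n hcB
  refine ⟨Nat.pair n c, hjn.trans (Nat.left_le_pair n c), hlt.trans_le
    (Finset.le_sup (f := fun n => Nat.pair n (B n (a n))) (Finset.mem_range.2 hng)), fun i hi => ?_⟩
  simp only [Nat.unpair_pair, List.getD_eq_getElem _ _ hc, hcy]
  refine hxy i (hi.trans_le ?_)
  rw [ha1]
  exact (Finset.le_sup (f := f) (Finset.mem_range.2 hlt)).trans (Nat.le_add_left _ _)

/-- If a translate of a nonempty closed set `E` is covered by an increasing sequence of closed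
sets, then a relatively open piece of it is contained in almost all of them. -/
lemma exists_piece_of_subset_iUnion {E : Set Cantor} (hE : IsClosed E) (hne : E.Nonempty)
    {C : ℕ → Set Cantor} (hmono : Monotone C) (hcl : ∀ n, IsClosed (C n)) {x : Cantor}
    (hx : ∀ e ∈ E, x + e ∈ ⋃ n, C n) :
    ∃ e₀ ∈ E, ∃ k, ∀ e ∈ E, (∀ i < k, e i = e₀ i) → ∀ j ≥ k, x + e ∈ C j := by
  have : CompactSpace E := isCompact_iff_compactSpace.1 hE.isCompact
  have : Nonempty E := hne.to_subtype
  obtain ⟨n, e₀, he₀⟩ := nonempty_interior_of_iUnion_of_closed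
    (f := fun n => (fun e : E => x + (e : Cantor)) ⁻¹' C n)
    (fun n => (hcl n).preimage (by fun_prop))
    (by
      rw [← Set.preimage_iUnion, Set.eq_univ_iff_forall]
      exact fun e => hx e e.2)
  obtain ⟨t, htC, hto, het⟩ := mem_interior.1 he₀
  obtain ⟨U, hU, rfl⟩ := isOpen_induced_iff.1 hto
  obtain ⟨k, hk⟩ := exists_cylinder_subset hU het
  refine ⟨e₀, e₀.2, max n k, fun e he hek j hj => hmono ((le_max_left n k).trans hj) ?_⟩
  exact @htC ⟨e, he⟩ (hk fun i hi => hek i (lt_max_of_lt_right hi))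

theorem IsAdditive.isGroupCovered_of_meager {X : Set Cantor} (hX : IsAdditive meagerIdeal X) :
    IsGroupCovered X := by
  classical
  refine isGroupCovered_of_finset (fun _ k => 2 ^ k) fun a ha => ?_
  let M : Set Cantor := {m | ∀ n, ∃ i, a n ≤ i ∧ i < a (n + 1) ∧ m i ≠ 0}
  have hMc : IsClosed M := by
    have : M = ⋂ n, {m | ∃ i, a n ≤ i ∧ i < a (n + 1) ∧ m i ≠ 0} := by
      ext m; simp [M]
    rw [this]
    refine isClosed_iInter fun n => (isClopen_of_cylinder (a (n + 1)) ?_).1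
    rintro m ⟨i, h₁, h₂, h₃⟩ y hy
    exact ⟨i, h₁, h₂, (hy i h₂).symm ▸ h₃⟩
  have hMne : M.Nonempty := ⟨1, fun n => ⟨a n, le_rfl, ha n.lt_succ_self, one_ne_zero⟩⟩
  have hMm : M ∈ meagerIdeal := by
    refine IsNowhereDense.isMeagre ?_
    rw [hMc.isNowhereDense_iff, Set.eq_empty_iff_forall_notMem]
    intro m hm
    obtain ⟨k, hk⟩ := exists_cylinder_subset isOpen_interior hm
    have hmem : splice k m 0 ∈ M := interior_subset (hk fun i hi => splice_of_lt _ _ hi)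
    obtain ⟨i, h₁, -, h₃⟩ := hmem k
    exact h₃ (splice_of_le _ _ (ha.le_apply.trans h₁))
  obtain ⟨C, hmono, hcl, hint, hXC⟩ := exists_monotone_closed_of_isMeagre (hX M hMm)
  choose l hl y hy using fun j => exists_pattern (hcl j) (hint j) (a j)
  refine ⟨l, fun j n => (words (a n)).image fun w => splice (a n) w (y j),
    fun j n => Finset.card_image_le.trans (card_words_le _), fun x hx => ?_⟩
  obtain ⟨e, he, k, hk⟩ := exists_piece_of_subset_iUnion hMc hMne hmono hcl
    (x := x) fun m hm => hXC (Set.add_mem_add hx hm)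
  refine eventually_atTop.2 ⟨k, fun j hj => ?_⟩
  have key : ∃ n, j ≤ n ∧ n < l j ∧ ∀ i, a n ≤ i → i < a (n + 1) → x i = y j i := by
    by_contra! hcon
    -- Replacing `e` by `x + y j` on the blocks from `j` to `l j` keeps it in `M`, as `x` differs
    -- from `y j` on each of them, yet makes `x + m` follow the pattern forbidden in `C j`.
    let m : Cantor := fun i => if a j ≤ i ∧ i < a (l j) then x i + y j i else e i
    have hmM : m ∈ M := by
      intro n
      by_cases hn : j ≤ n ∧ n < l j
      · obtain ⟨i, h₁, h₂, h₃⟩ := hcon n hn.1 hn.2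
        refine ⟨i, h₁, h₂, ?_⟩
        have : a j ≤ i ∧ i < a (l j) :=
          ⟨(ha.monotone hn.1).trans h₁, h₂.trans_le (ha.monotone hn.2)⟩
        simp only [m, if_pos this]
        rwa [ne_eq, CharTwo.add_eq_zero]
      · obtain ⟨i, h₁, h₂, h₃⟩ := he n
        refine ⟨i, h₁, h₂, ?_⟩
        have : ¬ (a j ≤ i ∧ i < a (l j)) := by
          rintro ⟨h, h'⟩
          exact hn ⟨Nat.lt_succ_iff.1 (ha.lt_iff_lt.1 (h.trans_lt h₂)),
            ha.lt_iff_lt.1 (h₁.trans_lt h')⟩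
        simpa only [m, if_neg this] using h₃
    refine hy j (x + m) (fun i h₁ h₂ => ?_) (hk m hmM (fun i hi => ?_) j hj)
    · have : a j ≤ i ∧ i < a (l j) := ⟨h₁, h₂.trans_le ha.le_apply⟩
      simp [m, if_pos this, ← add_assoc, CharTwo.add_self_eq_zero]
    · have : ¬ (a j ≤ i ∧ i < a (l j)) := fun h =>
        absurd (ha.le_apply.trans h.1 : j ≤ i) (by omega)
      simp only [m, if_neg this]
  obtain ⟨n, hjn, hnl, hn⟩ := key
  refine ⟨n, hjn, hnl, _, Finset.mem_image_of_mem _ (splice_zero_mem_words (a n) x),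
    fun i hi => ?_⟩
  rcases lt_or_ge i (a n) with h | h
  · rw [splice_of_lt _ _ h, splice_of_lt _ _ h]
  · rw [splice_of_le _ _ h, hn i h hi]

/-! ### Quadratic forms and the second moment bound -/

/-- The quadratic form pairing the even coordinates with the odd ones, over the pairs in `s`. -/
def quad (s : Finset ℕ) (z : Cantor) : ZMod 2 := ∑ i ∈ s, z (2 * i) * z (2 * i + 1)

lemma quad_congr {s : Finset ℕ} {z z' : Cantor}
    (h : ∀ i ∈ s, z (2 * i) = z' (2 * i) ∧ z (2 * i + 1) = z' (2 * i + 1)) :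
    quad s z = quad s z' :=
  Finset.sum_congr rfl fun i hi => by rw [(h i hi).1, (h i hi).2]

lemma quad_congr_Ico {a b : ℕ} {z z' : Cantor} (h : ∀ i, 2 * a ≤ i → i < 2 * b → z i = z' i) :
    quad (Finset.Ico a b) z = quad (Finset.Ico a b) z' :=
  quad_congr fun i hi => by
    rw [Finset.mem_Ico] at hi
    exact ⟨h _ (by omega) (by omega), h _ (by omega) (by omega)⟩

/-- The point whose only nonzero coordinate is the `k`-th one. -/
def flip (k : ℕ) : Cantor := Pi.single k 1

lemma flip_self (k : ℕ) : flip k k = 1 := Pi.single_eq_same _ _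

lemma flip_of_ne {k i : ℕ} (h : i ≠ k) : flip k i = 0 := Pi.single_eq_of_ne h _

lemma quad_flip_even_add {s : Finset ℕ} {i : ℕ} (hi : i ∈ s) (z : Cantor) :
    quad s (flip (2 * i) + z) = quad s z + z (2 * i + 1) := by
  rw [quad, quad, ← Finset.add_sum_erase _ _ hi, ← Finset.add_sum_erase s (fun j => z _ * z _) hi,
    Finset.sum_congr rfl (g := fun j => z (2 * j) * z (2 * j + 1))]
  · simp only [Pi.add_apply, flip_self, flip_of_ne (show 2 * i + 1 ≠ 2 * i by omega)]
    ring
  · intro j hj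
    have := Finset.ne_of_mem_erase hj
    simp [flip_of_ne (show 2 * j ≠ 2 * i by omega), flip_of_ne (show 2 * j + 1 ≠ 2 * i by omega)]

lemma quad_flip_odd_add {s : Finset ℕ} {i : ℕ} (hi : i ∈ s) (z : Cantor) :
    quad s (flip (2 * i + 1) + z) = quad s z + z (2 * i) := by
  rw [quad, quad, ← Finset.add_sum_erase _ _ hi, ← Finset.add_sum_erase s (fun j => z _ * z _) hi,
    Finset.sum_congr rfl (g := fun j => z (2 * j) * z (2 * j + 1))]
  · simp only [Pi.add_apply, flip_self, flip_of_ne (show 2 * i ≠ 2 * i + 1 by omega)]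
    ring
  · intro j hj
    have := Finset.ne_of_mem_erase hj
    simp [flip_of_ne (show 2 * j ≠ 2 * i + 1 by omega),
      flip_of_ne (show 2 * j + 1 ≠ 2 * i + 1 by omega)]

lemma continuous_quad (s : Finset ℕ) : Continuous (quad s) := by
  unfold quad; fun_prop

/-- The nontrivial character of `ZMod 2`. -/
def sign (b : ZMod 2) : ℝ := if b = 0 then 1 else -1

lemma sign_add (b c : ZMod 2) : sign (b + c) = sign b * sign c := by
  have h01 : ∀ c : ZMod 2, c = 0 ∨ c = 1 := by decide
  rcases h01 b with rfl | rfl <;> rcases h01 c with rfl | rfl <;>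
    simp [sign, CharTwo.add_self_eq_zero]

lemma sign_mul_self (b : ZMod 2) : sign b * sign b = 1 := by
  rw [sign]; split_ifs <;> norm_num

lemma sign_of_ne_zero {b : ZMod 2} (h : b ≠ 0) : sign b = -1 := if_neg h

lemma abs_sign (b : ZMod 2) : |sign b| = 1 := by
  rw [sign]; split_ifs <;> norm_num

lemma setIntegral_eq_zero_of_flip {v e : Cantor} {k : ℕ} (he : ∀ i < k, e i = 0) {h : Cantor → ℝ}
    (hh : ∀ z, h (e + z) = - h z) : ∫ z in PiNat.cylinder v k, h z ∂haar = 0 := by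
  have hm : MeasurableSet (PiNat.cylinder v k) := (PiNat.isOpen_cylinder _ v k).measurableSet
  rw [← integral_indicator hm]
  have h1 := integral_add_left_eq_self (μ := haar) ((PiNat.cylinder v k).indicator h) e
  have h2 : ∀ z, (PiNat.cylinder v k).indicator h (e + z) =
      - (PiNat.cylinder v k).indicator h z := by
    intro z
    have : e + z ∈ PiNat.cylinder v k ↔ z ∈ PiNat.cylinder v k := by
      simp only [PiNat.mem_cylinder_iff]
      exact forall₂_congr fun i hi => by simp [he i hi]
    by_cases hz : z ∈ PiNat.cylinder v k
    · rw [Set.indicator_of_mem hz, Set.indicator_of_mem (this.2 hz), hh]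
    · rw [Set.indicator_of_notMem hz, Set.indicator_of_notMem (fun h => hz (this.1 h)), neg_zero]
  simp only [h2, integral_neg] at h1
  linarith

/-- Flipping the partner of a coordinate `i` where `u` and `u'` differ changes the two forms by `z i
+ u i` and `z i + u' i`. These differ, so the product changes sign; the flip preserves Haar measure
and the cylinder. -/
lemma setIntegral_sign_mul_sign {a b : ℕ} (v : Cantor) {u u' : Cantor}
    (h : ∃ i, 2 * a ≤ i ∧ i < 2 * b ∧ u i ≠ u' i) :
    ∫ z in PiNat.cylinder v (2 * a), sign (quad (Finset.Ico a b) (z + u)) *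
      sign (quad (Finset.Ico a b) (z + u')) ∂haar = 0 := by
  obtain ⟨i, h₁, h₂, hne⟩ := h
  have hsign : ∀ c : ZMod 2, sign (c + u i) * sign (c + u' i) = -1 := by
    intro c
    rw [← sign_add]
    refine sign_of_ne_zero ?_
    revert hne
    generalize u i = p; generalize u' i = q
    revert c p q; decide
  rcases Nat.even_or_odd' i with ⟨m, rfl | rfl⟩
  · have hm : m ∈ Finset.Ico a b := Finset.mem_Ico.2 ⟨by omega, by omega⟩
    refine setIntegral_eq_zero_of_flip (e := flip (2 * m + 1))
      (fun i hi => flip_of_ne (by omega)) fun z => ?_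
    rw [add_assoc, add_assoc, quad_flip_odd_add hm, quad_flip_odd_add hm, sign_add, sign_add,
      mul_mul_mul_comm]
    simp only [Pi.add_apply]
    rw [hsign, mul_neg_one]
  · have hm : m ∈ Finset.Ico a b := Finset.mem_Ico.2 ⟨by omega, by omega⟩
    refine setIntegral_eq_zero_of_flip (e := flip (2 * m))
      (fun i hi => flip_of_ne (by omega)) fun z => ?_
    rw [add_assoc, add_assoc, quad_flip_even_add hm, quad_flip_even_add hm, sign_add, sign_add,
      mul_mul_mul_comm]
    simp only [Pi.add_apply]
    rw [hsign, mul_neg_one]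

lemma measurable_sign_quad (s : Finset ℕ) (u : Cantor) :
    Measurable fun z => sign (quad s (z + u)) :=
  (measurable_of_countable sign).comp
    ((continuous_quad s).comp (continuous_add_const u)).measurable

/-- Second moment bound: few points avoid all the translates of the quadric `quad = 0` by a large
set of translations. -/
lemma card_mul_haar_le {a b : ℕ} (v : Cantor) (U : Finset Cantor)
    (hU : ∀ u ∈ U, ∀ u' ∈ U, u ≠ u' → ∃ i, 2 * a ≤ i ∧ i < 2 * b ∧ u i ≠ u' i) :
    U.card * haar.real {z ∈ PiNat.cylinder v (2 * a) | ∀ u ∈ U, quad (Finset.Ico a b) (z + u) ≠ 0} ≤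
      (1 / 2) ^ (2 * a) := by
  set W := {z ∈ PiNat.cylinder v (2 * a) | ∀ u ∈ U, quad (Finset.Ico a b) (z + u) ≠ 0}
  set S : Cantor → ℝ := fun z => ∑ u ∈ U, sign (quad (Finset.Ico a b) (z + u))
  have hint : ∀ u u', Integrable (fun z => sign (quad (Finset.Ico a b) (z + u)) *
      sign (quad (Finset.Ico a b) (z + u'))) (haar.restrict (PiNat.cylinder v (2 * a))) := by
    intro u u'
    refine Integrable.of_bound
      ((measurable_sign_quad _ u).mul (measurable_sign_quad _ u')).aestronglyMeasurable 1
      (ae_of_all _ fun z => ?_)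
    rw [Real.norm_eq_abs, abs_mul, abs_sign, abs_sign, one_mul]
  have hSS : ∀ z, S z * S z = ∑ u ∈ U, ∑ u' ∈ U, sign (quad (Finset.Ico a b) (z + u)) *
      sign (quad (Finset.Ico a b) (z + u')) := fun z => Finset.sum_mul_sum _ _ _ _
  have hSint : Integrable (fun z => S z * S z) (haar.restrict (PiNat.cylinder v (2 * a))) := by
    simp only [hSS]
    exact integrable_finsetSum _ fun u _ => integrable_finsetSum _ fun u' _ => hint u u'
  -- Only the diagonal terms survive. Since `S = -U.card` on `W`, comparing with the integral over
  -- `W` gives the bound.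
  have hmoment : ∫ z in PiNat.cylinder v (2 * a), S z * S z ∂haar = U.card * (1 / 2) ^ (2 * a) := by
    simp only [hSS]
    rw [integral_finsetSum _ fun u _ => integrable_finsetSum _ fun u' _ => hint u u']
    rw [← nsmul_eq_mul]
    refine Finset.sum_eq_card_nsmul fun u hu => ?_
    rw [integral_finsetSum _ fun u' _ => hint u u', Finset.sum_eq_single u]
    · simp only [sign_mul_self]
      simp [haar_real_cylinder]
    · intro u' hu' hne
      exact setIntegral_sign_mul_sign v (hU u hu u' hu' hne.symm)
    · exact fun h => absurd hu h
  have hWm : MeasurableSet W := by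
    refine (PiNat.isOpen_cylinder _ v _).measurableSet.inter
      (s₂ := {z | ∀ u ∈ U, quad (Finset.Ico a b) (z + u) ≠ 0}) ?_
    rw [show {z | ∀ u ∈ U, quad (Finset.Ico a b) (z + u) ≠ 0} =
      ⋂ u ∈ U, {z | quad (Finset.Ico a b) (z + u) ≠ 0} by ext; simp]
    exact U.measurableSet_biInter fun u _ => ((isOpen_discrete {0}ᶜ).preimage
      ((continuous_quad _).comp (continuous_add_const u))).measurableSet
  have hWS : ∀ z ∈ W, S z * S z = (U.card : ℝ) * U.card := by
    intro z hz
    have : S z = - U.card := by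
      simp only [S]
      rw [Finset.sum_congr rfl fun u hu => sign_of_ne_zero (hz.2 u hu)]
      simp
    rw [this, neg_mul_neg]
  have hle : ∫ z in W, S z * S z ∂haar ≤ ∫ z in PiNat.cylinder v (2 * a), S z * S z ∂haar :=
    setIntegral_mono_set hSint (ae_of_all _ fun z => mul_self_nonneg _)
      (LE.le.eventuallyLE (Set.sep_subset _ _))
  rw [setIntegral_congr_fun hWm hWS, setIntegral_const, hmoment, smul_eq_mul] at hle
  rcases Nat.eq_zero_or_pos U.card with h0 | hpos
  · rw [h0]; simp
  · have hpos' : (0 : ℝ) < U.card := by exact_mod_cast hpos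
    refine le_of_mul_le_mul_left ?_ hpos'
    linarith

lemma eq_zero_of_mem_words {l i : ℕ} {w : Cantor} (hw : w ∈ words l) (hi : l ≤ i) : w i = 0 := by
  classical
  obtain ⟨w', -, rfl⟩ := Finset.mem_image.1 hw
  exact dif_neg hi.not_gt

lemma haar_real_eq_sum_words {S : Set Cantor} (hS : MeasurableSet S) (l : ℕ) :
    haar.real S = ∑ w ∈ words l, haar.real (S ∩ PiNat.cylinder w l) := by
  rw [← measureReal_biUnion_finset]
  · congr 1
    ext z
    simp only [Set.mem_iUnion, Set.mem_inter_iff]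
    exact ⟨fun h => ⟨_, splice_zero_mem_words l z, h, fun i hi => (splice_of_lt _ _ hi).symm⟩,
      fun ⟨_, _, h, _⟩ => h⟩
  · intro w hw w' hw' hne
    refine Set.disjoint_left.2 fun z hz hz' => hne ?_
    ext i
    rcases lt_or_ge i l with h | h
    · rw [← hz.2 i h, ← hz'.2 i h]
    · rw [eq_zero_of_mem_words hw h, eq_zero_of_mem_words hw' h]
  · exact fun w _ => hS.inter (PiNat.isOpen_cylinder _ w l).measurableSet

/-! ### Sparsity in cylinders -/

/-- `D` has relative measure at most `θ` in the cylinder of length `k` around `z`. -/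
def IsSparseAt (D : Set Cantor) (θ : ℝ) (k : ℕ) (z : Cantor) : Prop :=
  haar.real (D ∩ PiNat.cylinder z k) ≤ θ * (1 / 2) ^ k

lemma IsSparseAt.congr {D : Set Cantor} {θ : ℝ} {k : ℕ} {z z' : Cantor}
    (h : IsSparseAt D θ k z) (hz : z' ∈ PiNat.cylinder z k) : IsSparseAt D θ k z' := by
  rwa [IsSparseAt, PiNat.mem_cylinder_iff_eq.1 hz]

lemma measurableSet_isSparseAt (D : Set Cantor) (θ : ℝ) (k : ℕ) :
    MeasurableSet {z | IsSparseAt D θ k z} :=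
  (isClopen_of_cylinder k fun _ hz _ hy => IsSparseAt.congr hz hy).isOpen.measurableSet

/-- Markov's inequality for the relative measure of `D` in the cylinders of length `l`. -/
lemma mul_haar_not_isSparseAt_le {D : Set Cantor} (hD : MeasurableSet D) {θ : ℝ} (hθ : 0 ≤ θ)
    (v : Cantor) {k l : ℕ} (hkl : k ≤ l) :
    θ * haar.real (PiNat.cylinder v k ∩ {z | ¬ IsSparseAt D θ l z}) ≤
      haar.real (D ∩ PiNat.cylinder v k) := by
  have hm : MeasurableSet (PiNat.cylinder v k) := (PiNat.isOpen_cylinder _ v k).measurableSet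
  rw [haar_real_eq_sum_words (S := PiNat.cylinder v k ∩ {z | ¬ IsSparseAt D θ l z})
      (hm.inter (measurableSet_isSparseAt D θ l).compl) l,
    haar_real_eq_sum_words (hD.inter hm) l, Finset.mul_sum]
  refine Finset.sum_le_sum fun w _ => ?_
  rcases Set.eq_empty_or_nonempty
    (PiNat.cylinder v k ∩ {z | ¬ IsSparseAt D θ l z} ∩ PiNat.cylinder w l) with h | ⟨z, ⟨hzv, hz⟩, hzw⟩
  · rw [h]; simp
  · have hsub : PiNat.cylinder w l ⊆ PiNat.cylinder v k := by
      rw [← PiNat.mem_cylinder_iff_eq.1 hzw, ← PiNat.mem_cylinder_iff_eq.1 hzv]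
      exact PiNat.cylinder_anti z hkl
    rw [Set.inter_assoc D, Set.inter_eq_right.2 hsub, ← PiNat.mem_cylinder_iff_eq.1 hzw]
    refine le_trans ?_ (not_le.1 hz).le
    refine mul_le_mul_of_nonneg_left ?_ hθ
    rw [← haar_real_cylinder z l]
    exact measureReal_mono Set.inter_subset_right

/-- If `D` is sparse in a cylinder then there are few translations such that `D` fails to be
sparse at all points of the translated quadric. -/
lemma card_mul_le_of_isSparseAt {D : Set Cantor} (hD : MeasurableSet D) {θ θ' : ℝ} (hθ' : 0 < θ')
    {a b : ℕ} (hab : a ≤ b) {v : Cantor} (hv : IsSparseAt D θ (2 * a) v) (U : Finset Cantor)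
    (hU : ∀ u ∈ U, ∀ u' ∈ U, u ≠ u' → ∃ i, 2 * a ≤ i ∧ i < 2 * b ∧ u i ≠ u' i)
    (hbad : ∀ u ∈ U, ∀ z ∈ PiNat.cylinder v (2 * a), quad (Finset.Ico a b) (z + u) = 0 →
      ¬ IsSparseAt D θ' (2 * b) z) : U.card * (θ' - θ) ≤ θ' := by
  have h1 := card_mul_haar_le v U hU
  have h2 := mul_haar_not_isSparseAt_le hD hθ'.le v (show 2 * a ≤ 2 * b by omega)
  -- A sparse point cannot lie on any of the translated quadrics, so the sparse points, which by
  -- Markov fill at least a fraction `1 - θ/θ'` of the cylinder, are subject to the second moment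
  -- bound.
  have h3 : haar.real (PiNat.cylinder v (2 * a) ∩ {z | IsSparseAt D θ' (2 * b) z}) ≤
      haar.real {z ∈ PiNat.cylinder v (2 * a) | ∀ u ∈ U, quad (Finset.Ico a b) (z + u) ≠ 0} :=
    measureReal_mono fun z hz => ⟨hz.1, fun u hu h => hbad u hu z hz.1 h hz.2⟩
  have h4 := measureReal_inter_add_sdiff (μ := haar) (s := PiNat.cylinder v (2 * a))
    (measurableSet_isSparseAt D θ' (2 * b))
  rw [haar_real_cylinder] at h4
  have h5 : haar.real (PiNat.cylinder v (2 * a) \ {z | IsSparseAt D θ' (2 * b) z}) =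
    haar.real (PiNat.cylinder v (2 * a) ∩ {z | ¬ IsSparseAt D θ' (2 * b) z}) := rfl
  rw [h5] at h4
  have hv' : haar.real (D ∩ PiNat.cylinder v (2 * a)) ≤ θ * (1 / 2) ^ (2 * a) := hv
  have hp : (0 : ℝ) < (1 / 2) ^ (2 * a) := by positivity
  set p : ℝ := (1 / 2) ^ (2 * a)
  have h6 : (θ' - θ) * p ≤ θ' *
      haar.real {z ∈ PiNat.cylinder v (2 * a) | ∀ u ∈ U, quad (Finset.Ico a b) (z + u) ≠ 0} := by
    nlinarith
  have h7 : (U.card : ℝ) * ((θ' - θ) * p) ≤ θ' * p := by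
    calc (U.card : ℝ) * ((θ' - θ) * p) ≤ U.card * (θ' * _) :=
          mul_le_mul_of_nonneg_left h6 (Nat.cast_nonneg _)
      _ = θ' * (U.card * _) := by ring
      _ ≤ θ' * p := mul_le_mul_of_nonneg_left h1 hθ'.le
  refine le_of_mul_le_mul_right ?_ hp
  linarith

/-! ### The null quadric -/

/-- The points at which all the quadratic forms of the given consecutive blocks vanish. -/
def quadric (a : ℕ → ℕ) : Set Cantor := {e | ∀ n, quad (Finset.Ico (a n) (a (n + 1))) e = 0}

lemma isClosed_quadric (a : ℕ → ℕ) : IsClosed (quadric a) := by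
  have : quadric a = ⋂ n, {e | quad (Finset.Ico (a n) (a (n + 1))) e = 0} := by
    ext; simp [quadric]
  rw [this]
  exact isClosed_iInter fun n => isClosed_eq (continuous_quad _) continuous_const

lemma zero_mem_quadric (a : ℕ → ℕ) : 0 ∈ quadric a := fun n => by simp [quad]

lemma haar_quadric {a : ℕ → ℕ} (ha : StrictMono a) : haar (quadric a) = 0 := by
  let E : ℕ → Set Cantor := fun n => {e | ∀ m < n, quad (Finset.Ico (a m) (a (m + 1))) e = 0}
  have hEm : ∀ n, MeasurableSet (E n) := fun n => by
    have : E n = ⋂ m ∈ Set.Iio n, {e | quad (Finset.Ico (a m) (a (m + 1))) e = 0} := by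
      ext; simp [E]
    rw [this]
    exact (isClosed_biInter fun m _ =>
      isClosed_eq (continuous_quad _) continuous_const).measurableSet
  have hstep : ∀ n, haar.real (E (n + 1)) ≤ 3 / 4 * haar.real (E n) := by
    intro n
    set B := E n \ E (n + 1)
    set I := Finset.Ico (a n) (a (n + 1))
    have hI : a n ∈ I := Finset.mem_Ico.2 ⟨le_rfl, ha n.lt_succ_self⟩
    have hsub : E (n + 1) ⊆ E n := fun e he m hm => he m (by omega)
    have hB : ∀ e ∈ E n, quad I e ≠ 0 → e ∈ B := fun e he h =>
      ⟨he, fun h' => h (h' n n.lt_succ_self)⟩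
    have hinv : ∀ k ≥ 2 * a n, ∀ e ∈ E n, flip k + e ∈ E n := by
      intro k hk e he m hm
      rw [← he m hm]
      refine quad_congr_Ico fun i _ hi => ?_
      have : a (m + 1) ≤ a n := ha.monotone hm
      simp [flip_of_ne (show i ≠ k by omega)]
    -- At a zero of the form, flipping one or both coordinates of the first pair of block `n` makes
    -- the form nonzero. Three translates of `B` thus cover `E (n + 1)`, whence the factor `3 / 4`.
    have hcov : E (n + 1) ⊆ (flip (2 * a n) +ᵥ B) ∪ (flip (2 * a n + 1) +ᵥ B) ∪
        ((flip (2 * a n) + flip (2 * a n + 1)) +ᵥ B) := by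
      intro e he
      have he0 : quad I e = 0 := he n n.lt_succ_self
      have h01 : ∀ c : ZMod 2, c ≠ 0 → c = 1 := by decide
      by_cases h₁ : e (2 * a n + 1) = 0
      · by_cases h₂ : e (2 * a n) = 0
        · refine Or.inr (Set.mem_vadd_set.2 ⟨flip (2 * a n + 1) + (flip (2 * a n) + e),
            hB _ (hinv _ (by omega) _ (hinv _ le_rfl _ (hsub he))) ?_, ?_⟩)
          · rw [quad_flip_odd_add hI, quad_flip_even_add hI]
            simp [he0, h₁, h₂, flip_self]
          · rw [vadd_eq_add, ← add_assoc (flip (2 * a n + 1)), add_comm (flip (2 * a n + 1)),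
              ← add_assoc, add_self, zero_add]
        · refine Or.inl (Or.inr (Set.mem_vadd_set.2 ⟨flip (2 * a n + 1) + e,
            hB _ (hinv _ (by omega) _ (hsub he)) ?_, ?_⟩))
          · rw [quad_flip_odd_add hI, he0, h01 _ h₂]; decide
          · rw [vadd_eq_add, ← add_assoc, add_self, zero_add]
      · refine Or.inl (Or.inl (Set.mem_vadd_set.2 ⟨flip (2 * a n) + e,
          hB _ (hinv _ le_rfl _ (hsub he)) ?_, ?_⟩))
        · rw [quad_flip_even_add hI, he0, h01 _ h₁]; decide
        · rw [vadd_eq_add, ← add_assoc, add_self, zero_add]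
    have h1 : haar.real (E (n + 1)) ≤ haar.real B + haar.real B + haar.real B := by
      refine (measureReal_mono hcov).trans ((measureReal_union_le _ _).trans
        (add_le_add ((measureReal_union_le _ _).trans (add_le_add ?_ ?_)) ?_)) <;>
      simp [Measure.real, measure_vadd]
    have h2 := measureReal_sdiff_add_inter (μ := haar) (s := E n) (hEm (n + 1))
    rw [Set.inter_eq_right.2 hsub] at h2
    change haar.real B + _ = _ at h2
    linarith
  have hE : ∀ n, haar.real (E n) ≤ (3 / 4) ^ n := by
    intro n
    induction n with
    | zero => simp
    | succ n ih => rw [pow_succ']; exact (hstep n).trans (by linarith)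
  have hreal : haar.real (quadric a) ≤ 0 :=
    ge_of_tendsto' (tendsto_pow_atTop_nhds_zero_of_lt_one (by norm_num) (by norm_num))
      fun n => (measureReal_mono (fun e (he : e ∈ quadric a) m _ => he m : quadric a ⊆ E n)).trans (hE n)
  exact (measureReal_eq_zero_iff).1 (le_antisymm hreal measureReal_nonneg)

/-! ### Steering towards sparsity, and the implication from `𝓔`-additivity -/

/-- The sparsity threshold at level `n`. -/
noncomputable def threshold (n : ℕ) : ℝ := (n + 1) / (n + 2)

lemma threshold_pos (n : ℕ) : 0 < threshold n := by unfold threshold; positivity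

lemma threshold_lt_one (n : ℕ) : threshold n < 1 := by
  unfold threshold; rw [div_lt_one (by positivity)]; linarith

lemma half_le_threshold (n : ℕ) : 1 / 2 ≤ threshold n := by
  unfold threshold
  rw [div_le_div_iff₀ (by norm_num) (by positivity)]
  have : (0 : ℝ) ≤ n := n.cast_nonneg
  linarith

/-- Consecutive thresholds differ by `1 / ((n + 2) * (n + 3))`; the room gained at each level bounds
the number of bad translations. -/
lemma card_le_of_mul_threshold {m n : ℕ}
    (h : m * (threshold (n + 1) - threshold n) ≤ threshold (n + 1)) : m ≤ (n + 2) ^ 2 := by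
  unfold threshold at h
  push_cast at h
  have h2 : (0 : ℝ) < n + 2 := by positivity
  have h3 : (0 : ℝ) < n + 1 + 2 := by positivity
  have e : ((n : ℝ) + 1 + 1) / (n + 1 + 2) - (n + 1) / (n + 2) = 1 / ((n + 1 + 2) * (n + 2)) := by
    field_simp; ring
  rw [e, mul_one_div, div_le_div_iff₀ (by positivity) h3] at h
  have h' : (m : ℝ) * (n + 1 + 2) ≤ (n + 2) ^ 2 * (n + 1 + 2) := by linarith
  exact_mod_cast le_of_mul_le_mul_right h' h3

open scoped Classical in
/-- The translations, normalised to live on the `n`-th block, for which no point of the translated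
quadric near `v` is a point of sparsity of `D` at the next level. -/
noncomputable def badTranslations (D : Set Cantor) (a : ℕ → ℕ) (n : ℕ) (v : Cantor) :
    Finset Cantor :=
  ((words (2 * a (n + 1))).image (splice (2 * a n) 0)).filter fun u =>
    ∀ z ∈ PiNat.cylinder v (2 * a n), quad (Finset.Ico (a n) (a (n + 1))) (z + u) = 0 →
      ¬ IsSparseAt D (threshold (n + 1)) (2 * a (n + 1)) z

lemma card_badTranslations_le {D : Set Cantor} (hD : MeasurableSet D) {a : ℕ → ℕ}
    (ha : StrictMono a) {n : ℕ} {v : Cantor} (hv : IsSparseAt D (threshold n) (2 * a n) v) :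
    (badTranslations D a n v).card ≤ (n + 2) ^ 2 := by
  classical
  refine card_le_of_mul_threshold (card_mul_le_of_isSparseAt hD (threshold_pos _)
    (ha n.lt_succ_self).le hv _ (fun u hu u' hu' hne => ?_)
    fun u hu => (Finset.mem_filter.1 hu).2)
  obtain ⟨w, hw, rfl⟩ := Finset.mem_image.1 (Finset.mem_filter.1 hu).1
  obtain ⟨w', hw', rfl⟩ := Finset.mem_image.1 (Finset.mem_filter.1 hu').1
  by_contra! hcon
  refine hne ?_
  ext i
  rcases lt_or_ge i (2 * a n) with h | h
  · rw [splice_of_lt _ _ h, splice_of_lt _ _ h]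
  · rcases lt_or_ge i (2 * a (n + 1)) with h' | h'
    · rw [hcon i h h']
    · rw [splice_of_le _ _ h, splice_of_le _ _ h, eq_zero_of_mem_words hw h',
        eq_zero_of_mem_words hw' h']

open scoped Classical in
/-- Representatives of the cylinders that stop the construction of points of sparsity. -/
noncomputable def stoppingPoints (D : Set Cantor) (a : ℕ → ℕ) (n : ℕ) : Finset Cantor :=
  (words (2 * a n)).biUnion fun w =>
    ((words (2 * a n)).filter (IsSparseAt D (threshold n) (2 * a n))).biUnion fun v =>
      (badTranslations D a n v).image (splice (2 * a n) w)

/-- The two powers of 2 count the heads of `x` and of the current sparse point. Nothing depends on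
`a (n + 1)`, as `isGroupCovered_of_finset` requires. -/
lemma card_stoppingPoints_le {D : Set Cantor} (hD : MeasurableSet D) {a : ℕ → ℕ}
    (ha : StrictMono a) (n : ℕ) :
    (stoppingPoints D a n).card ≤ 2 ^ (2 * a n) * (2 ^ (2 * a n) * (n + 2) ^ 2) := by
  classical
  refine (Finset.card_biUnion_le_card_mul _ _ _ fun w _ => ?_).trans
    (Nat.mul_le_mul_right _ (card_words_le _))
  refine (Finset.card_biUnion_le_card_mul _ _ _ fun v hv => ?_).trans
    (Nat.mul_le_mul_right _ ((Finset.card_filter_le _ _).trans (card_words_le _)))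
  exact Finset.card_image_le.trans (card_badTranslations_le hD ha (Finset.mem_filter.1 hv).2)

/-- A point of sparsity can be continued to the next level along `x` plus the quadric, unless `x`
lies in one of the stopping cylinders. -/
lemma exists_next_isSparseAt {D : Set Cantor} {a : ℕ → ℕ} {n : ℕ} {x z : Cantor}
    (hz : IsSparseAt D (threshold n) (2 * a n) z)
    (hx : ∀ y ∈ stoppingPoints D a n, ∃ i < 2 * a (n + 1), x i ≠ y i) :
    ∃ z' ∈ PiNat.cylinder z (2 * a n), quad (Finset.Ico (a n) (a (n + 1))) (z' + x) = 0 ∧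
      IsSparseAt D (threshold (n + 1)) (2 * a (n + 1)) z' := by
  classical
  set v := splice (2 * a n) z 0
  have hvz : v ∈ PiNat.cylinder z (2 * a n) := fun i hi => splice_of_lt _ _ hi
  set u := splice (2 * a n) 0 (splice (2 * a (n + 1)) x 0)
  have hux : ∀ i, 2 * a n ≤ i → i < 2 * a (n + 1) → u i = x i := fun i h h' => by
    simp only [u, splice_of_le _ _ h, splice_of_lt _ _ h']
  have hu : u ∉ badTranslations D a n v := by
    intro hu
    have hmem : splice (2 * a n) (splice (2 * a n) x 0) u ∈ stoppingPoints D a n :=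
      Finset.mem_biUnion.2 ⟨_, splice_zero_mem_words _ x, Finset.mem_biUnion.2
        ⟨v, Finset.mem_filter.2 ⟨splice_zero_mem_words _ z, hz.congr hvz⟩,
          Finset.mem_image_of_mem _ hu⟩⟩
    obtain ⟨i, hi, hne⟩ := hx _ hmem
    refine hne ?_
    rcases lt_or_ge i (2 * a n) with h | h
    · rw [splice_of_lt _ _ h, splice_of_lt _ _ h]
    · rw [splice_of_le _ _ h, hux i h hi]
  have hu' : ¬ ∀ z ∈ PiNat.cylinder v (2 * a n),
      quad (Finset.Ico (a n) (a (n + 1))) (z + u) = 0 →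
      ¬ IsSparseAt D (threshold (n + 1)) (2 * a (n + 1)) z := fun h =>
    hu (Finset.mem_filter.2 ⟨Finset.mem_image_of_mem _ (splice_zero_mem_words _ x), h⟩)
  push Not at hu'
  obtain ⟨z', hz', hq, hs⟩ := hu'
  refine ⟨z', ?_, ?_, hs⟩
  · rwa [← PiNat.mem_cylinder_iff_eq.1 hvz]
  · rw [← hq]
    refine quad_congr_Ico fun i h h' => ?_
    simp only [Pi.add_apply, hux i h h']

theorem IsAdditive.isGroupCovered_of_nullFsigma {X : Set Cantor}
    (hX : IsAdditive nullFsigmaIdeal X) : IsGroupCovered X := by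
  refine isGroupCovered_of_finset (fun n k => 2 ^ (2 * k) * (2 ^ (2 * k) * (n + 2) ^ 2))
    fun a ha => ?_
  have hE : quadric a ∈ nullFsigmaIdeal :=
    ⟨fun _ => quadric a, fun _ => isClosed_quadric a, by simpa using haar_quadric ha,
      (Set.iUnion_const _).ge⟩
  obtain ⟨C, hmono, hcl, h0, hXC⟩ := exists_monotone_closed_of_nullFsigma (hX _ hE)
  -- With total measure at most half that of a cylinder of length `2 * a j`, the thickening is
  -- sparse at level `j` around every point.
  have hthick : ∀ j, ∃ N, j ≤ N ∧ haar.real (thick (C j) (2 * a N)) ≤ 1 / 2 * (1 / 2) ^ (2 * a j) := by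
    intro j
    obtain ⟨k, hk⟩ := exists_haar_thick_lt (hcl j) (h0 j)
      (ε := ENNReal.ofReal (1 / 2 * (1 / 2) ^ (2 * a j))) (by simp)
    refine ⟨max j k, le_max_left _ _, ?_⟩
    have hle : k ≤ 2 * a (max j k) := by
      have := (le_max_right j k).trans ha.le_apply
      omega
    exact ENNReal.toReal_le_of_le_ofReal (by positivity) (hk _ hle).le
  choose N hjN hN using hthick
  refine ⟨N, fun j n => stoppingPoints (thick (C j) (2 * a (N j))) a n,
    fun j n => card_stoppingPoints_le (isClopen_thick _ _).isOpen.measurableSet ha n,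
    fun x hx => ?_⟩
  obtain ⟨e₀, he₀, k, hk⟩ := exists_piece_of_subset_iUnion (isClosed_quadric a)
    ⟨0, zero_mem_quadric a⟩ hmono hcl (x := x) fun e he => hXC (Set.add_mem_add hx he)
  refine eventually_atTop.2 ⟨k, fun j hj => ?_⟩
  set D := thick (C j) (2 * a (N j)) with hDdef
  suffices h : ∃ n, j ≤ n ∧ n < N j ∧ ∃ y ∈ stoppingPoints D a n, ∀ i < 2 * a (n + 1), x i = y i by
    obtain ⟨n, h₁, h₂, y, hy, hxy⟩ := h
    exact ⟨n, h₁, h₂, y, hy, fun i hi => hxy i (by omega)⟩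
  by_contra! hcon
  -- If `x` avoids all stopping cylinders, sparse points can be continued up to level `N j` with `z
  -- + x` on the quadric. But then `z` agrees with a point of `C j` below `2 * a (N j)`, so its
  -- cylinder lies in `D` and has relative measure 1, above the threshold.
  have hchain : ∀ n, j ≤ n → n ≤ N j → ∃ z : Cantor, (∀ i < 2 * a j, z i = (x + e₀) i) ∧
      (∀ m, j ≤ m → m < n → quad (Finset.Ico (a m) (a (m + 1))) (z + x) = 0) ∧
      IsSparseAt D (threshold n) (2 * a n) z := by
    intro n hjn
    induction n, hjn using Nat.le_induction with
    | base =>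
      refine fun _ => ⟨x + e₀, fun _ _ => rfl, fun m h h' => by omega, ?_⟩
      refine (measureReal_mono Set.inter_subset_left).trans ((hN j).trans ?_)
      exact mul_le_mul_of_nonneg_right (half_le_threshold j) (by positivity)
    | succ n hjn ih =>
      intro hn
      obtain ⟨z, hz, hq, hs⟩ := ih (by omega)
      obtain ⟨z', hz', hq', hs'⟩ := exists_next_isSparseAt hs (hcon n hjn (by omega))
      have hmn : ∀ m ≤ n, 2 * a m ≤ 2 * a n := fun m hm =>
        Nat.mul_le_mul_left 2 (ha.monotone hm)
      refine ⟨z', fun i hi => (hz' i (hi.trans_le (hmn j hjn))).trans (hz i hi),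
        fun m hjm hm => ?_, hs'⟩
      rcases Nat.lt_succ_iff_lt_or_eq.1 hm with h | rfl
      · rw [← hq m hjm h]
        refine quad_congr_Ico fun i _ hi => ?_
        simp only [Pi.add_apply, hz' i (hi.trans_le (hmn (m + 1) h))]
      · exact hq'
  obtain ⟨z, hz, hq, hs⟩ := hchain (N j) (hjN j) le_rfl
  let e : Cantor := fun i => if 2 * a j ≤ i ∧ i < 2 * a (N j) then x i + z i else e₀ i
  have he : e ∈ quadric a := by
    intro n
    by_cases hn : j ≤ n ∧ n < N j
    · rw [← hq n hn.1 hn.2]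
      refine quad_congr_Ico fun i h₁ h₂ => ?_
      have h₃ := ha.monotone hn.1
      have h₄ := ha.monotone (Nat.succ_le_of_lt hn.2)
      rw [Nat.succ_eq_add_one] at h₄
      simp only [e, if_pos (show 2 * a j ≤ i ∧ i < 2 * a (N j) by omega), Pi.add_apply, add_comm]
    · rw [← he₀ n]
      refine quad_congr_Ico fun i h₁ h₂ => ?_
      refine if_neg ?_
      rintro ⟨h, h'⟩
      have h₃ : a j < a (n + 1) := by omega
      exact hn ⟨Nat.lt_succ_iff.1 (ha.lt_iff_lt.1 h₃), ha.lt_iff_lt.1 (by omega)⟩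
  have hjk : k ≤ 2 * a j := by
    have : k ≤ a j := le_trans hj ha.le_apply
    omega
  have hxe : x + e ∈ C j := hk e he (fun i hi => if_neg (by omega)) j hj
  have hze : ∀ i < 2 * a (N j), z i = (x + e) i := by
    intro i hi
    by_cases h : 2 * a j ≤ i
    · simp [e, h, hi, ← add_assoc, CharTwo.add_self_eq_zero]
    · rw [hz i (by omega)]
      simp [e, h]
  have hsub : PiNat.cylinder z (2 * a (N j)) ⊆ D := fun y hy =>
    ⟨x + e, hxe, fun i hi => (hy i hi).trans (hze i hi)⟩
  rw [IsSparseAt, Set.inter_eq_right.2 hsub, haar_real_cylinder] at hs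
  have hp : (0 : ℝ) < (1 / 2) ^ (2 * a (N j)) := by positivity
  nlinarith [threshold_lt_one (N j)]

end Cantor

/-! ### Hausdorff dimension and uhnull sets -/

/-- Enumerate by decreasing `r`: the `i`-th value is at most each of the `i` earlier ones. The
induction inserts a minimal element, which goes last. -/
lemma exists_enum_mul_le_sum {ι : Type*} [Nonempty ι] (A : Finset ι) (r : ι → ℝ≥0∞) :
    ∃ q : ℕ → ι, (∀ a ∈ A, ∃ i < A.card, q i = a) ∧
      ∀ i < A.card, ((i : ℝ≥0∞) + 1) * r (q i) ≤ ∑ a ∈ A, r a := by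
  classical
  induction A using Finset.induction_on_min_value r with
  | empty => exact ⟨fun _ => Classical.arbitrary ι, by simp, by simp⟩
  | insert a s ha hmin ih =>
    obtain ⟨q, hq, hr⟩ := ih
    rw [Finset.card_insert_of_notMem ha, Finset.sum_insert ha]
    refine ⟨Function.update q s.card a, fun b hb => ?_, fun i hi => ?_⟩
    · rcases Finset.mem_insert.1 hb with rfl | hb
      · exact ⟨s.card, Nat.lt_succ_self _, Function.update_self ..⟩
      · obtain ⟨i, hi, h⟩ := hq b hb
        exact ⟨i, by omega, by rw [Function.update_of_ne hi.ne, h]⟩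
    · rcases Nat.lt_succ_iff_lt_or_eq.1 hi with h | rfl
      · rw [Function.update_of_ne h.ne]
        exact (hr i h).trans le_add_self
      · rw [Function.update_self, add_mul, one_mul, add_comm]
        refine add_le_add le_rfl ?_
        rw [← nsmul_eq_mul]
        exact Finset.card_nsmul_le_sum s r _ hmin

/-- A compact set of vanishing one-dimensional Hausdorff measure has finite covers whose diameters
are small and tend to zero at a harmonic rate. -/
lemma IsCompact.exists_cover_mul_ediam_le {Z : Type*} [MetricSpace Z] [MeasurableSpace Z]
    [BorelSpace Z] {K : Set Z} (hK : IsCompact K) (h0 : μH[1] K = 0) {δ : ℝ≥0∞} (hδ : δ ≠ 0) :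
    ∃ (m : ℕ) (U : ℕ → Set Z), (∀ z ∈ K, ∃ i < m, z ∈ U i) ∧
      ∀ i < m, ((i : ℝ≥0∞) + 1) * Metric.ediam (U i) ≤ δ := by
  have hδ2 : δ / 2 ≠ 0 := (ENNReal.half_pos hδ).ne'
  -- Half of `δ` pays for the diameters of the cover; thickening by `ρ n` to open sets adds `2 * ρ
  -- n` to each, so the `ρ n` must sum to at most a quarter.
  have hδ4 : δ / 2 / 2 ≠ 0 := (ENNReal.half_pos hδ2).ne'
  rw [Measure.hausdorffMeasure_apply] at h0
  simp only [ENNReal.iSup_eq_zero] at h0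
  have h1 := (h0 1 one_pos).trans_lt (pos_iff_ne_zero.2 hδ2)
  simp only [iInf_lt_iff] at h1
  obtain ⟨t, hKt, -, hsum⟩ := h1
  obtain ⟨ρ, hρ, hρs⟩ := ENNReal.exists_pos_sum_of_countable hδ4 ℕ
  obtain ⟨A, hA⟩ := hK.elim_finite_subcover (fun n => Metric.thickening (ρ n) (t n))
    (fun n => Metric.isOpen_thickening)
    (hKt.trans (Set.iUnion_mono fun n => Metric.self_subset_thickening (hρ n) _))
  obtain ⟨q, hq, hr⟩ := exists_enum_mul_le_sum A fun n => Metric.ediam (t n) + 2 * ρ n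
  have htot : ∑ n ∈ A, (Metric.ediam (t n) + 2 * (ρ n : ℝ≥0∞)) ≤ δ := by
    rw [Finset.sum_add_distrib, ← Finset.mul_sum, ← ENNReal.add_halves δ]
    refine add_le_add ?_ ?_
    · refine le_trans (Finset.sum_le_sum fun n _ => ?_) ((ENNReal.sum_le_tsum A).trans hsum.le)
      rcases (t n).eq_empty_or_nonempty with h | h
      · simp [h]
      · simp [h]
    · rw [← ENNReal.add_halves (δ / 2), ← two_mul]
      gcongr
      exact (ENNReal.sum_le_tsum A).trans hρs.le
  refine ⟨A.card, fun i => Metric.thickening (ρ (q i)) (t (q i)), fun z hz => ?_, fun i hi => ?_⟩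
  · obtain ⟨n, hn, hzn⟩ := Set.mem_iUnion₂.1 (hA hz)
    obtain ⟨i, hi, rfl⟩ := hq n hn
    exact ⟨i, hi, hzn⟩
  · refine le_trans ?_ ((hr i hi).trans htot)
    gcongr
    exact Metric.ediam_thickening_le _

namespace Cantor

lemma dist_le_of_forall_lt {E : ℕ → Type*} [∀ n, TopologicalSpace (E n)]
    [∀ n, DiscreteTopology (E n)] {x y : ∀ n, E n} {n : ℕ} :
    letI := PiNat.metricSpace (E := E)
    dist y x ≤ (1 / 2) ^ n ↔ ∀ i < n, y i = x i :=
  PiNat.mem_cylinder_iff_dist_le.symm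

theorem isGroupCovered_of_isUHNull {X : Set Cantor} (hX : IsUHNull.{0, v} X) :
    IsGroupCovered X := by
  intro f₀
  let f : ℕ → ℕ := fun n => (Finset.range (n + 1)).sup f₀
  have hf₀ : ∀ n, f₀ n ≤ f n := fun n => Finset.le_sup (f := f₀) (Finset.self_mem_range_succ n)
  have hf : Monotone f := fun m n h => Finset.sup_mono (Finset.range_mono (by omega))
  -- Coordinate `n` of the recoding stores `x` below `f (2 ^ (n + 2))`, so distance at most `(1 / 2)
  -- ^ (l + 1)` forces agreement that far for `n = l`. `ULift` only places the target in the
  -- required universe.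
  let E : ℕ → Type v := fun n => ULift.{v} (Fin (f (2 ^ (n + 2))) → ZMod 2)
  let : MetricSpace (∀ n, E n) := PiNat.metricSpace
  let F : X → ∀ n, E n := fun x n => ULift.up fun i => (x : Cantor) i
  have hF : ∀ x y : X, ∀ n, F x n = F y n ↔
      ∀ i < f (2 ^ (n + 2)), (x : Cantor) i = (y : Cantor) i := by
    intro x y n
    exact ⟨fun h i hi => congrFun (congrArg ULift.down h) ⟨i, hi⟩,
      fun h => congrArg ULift.up (funext fun i => h i i.2)⟩
  have hFuc : UniformContinuous F := by
    rw [Metric.uniformContinuous_iff]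
    intro ε hε
    obtain ⟨n, hn⟩ := exists_pow_lt_of_lt_one hε (by norm_num : (1 / 2 : ℝ) < 1)
    refine ⟨(1 / 2) ^ f (2 ^ (n + 2)), by positivity, fun {x y} hxy => ?_⟩
    refine lt_of_le_of_lt (dist_le_of_forall_lt.2 fun k hk => (hF x y k).2 fun i hi => ?_) hn
    refine (dist_le_of_forall_lt (E := fun _ => ZMod 2)).1 hxy.le i (hi.trans_le (hf ?_))
    exact Nat.pow_le_pow_right two_pos (by omega)
  let Z := UniformSpace.Completion (Set.range F)
  let : MeasurableSpace Z := borel Z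
  have : BorelSpace Z := ⟨rfl⟩
  have hdim : upperDimH (Set.range F) < 1 := (hX _ F hFuc).trans_lt one_pos
  simp only [upperDimH, iInf_lt_iff] at hdim
  obtain ⟨K, ⟨K₀, hK₀, rfl⟩, hsub, hK⟩ := hdim
  have hzero : ∀ j, μH[1] (Set.accumulate K₀ j) = 0 := fun j => by
    have := hausdorffMeasure_of_dimH_lt (s := Set.accumulate K₀ j) (d := 1)
      ((dimH_mono (Set.accumulate_subset_iUnion j)).trans_lt hK)
    simpa using this
  -- The `i`-th set has diameter at most `1 / ((j + 2) * (i + 1)) ≤ 1 / (j + i + 2)`, which fits the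
  -- index `n = j + i` in group `j`.
  choose m U hU hUd using fun j : ℕ => (isCompact_accumulate hK₀ j).exists_cover_mul_ediam_le
    (hzero j) (δ := ((j : ℝ≥0∞) + 2)⁻¹) (by simp)
  let ι : X → Z := fun x => ((⟨F x, Set.mem_range_self x⟩ : Set.range F) : Z)
  have hp : ∀ j n, ∃ p : Cantor, ∀ x : X, ι x ∈ U j (n - j) → ∃ y : X, y = p ∧ ι y ∈ U j (n - j) := by
    intro j n
    by_cases h : ∃ y : X, ι y ∈ U j (n - j)
    · obtain ⟨y, hy⟩ := h
      exact ⟨y, fun _ _ => ⟨y, rfl, hy⟩⟩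
    · exact ⟨0, fun x hx => absurd ⟨x, hx⟩ h⟩
  choose p hp using hp
  refine ⟨fun j => j + m j, p, fun x hx => ?_⟩
  obtain ⟨k, hk⟩ := Set.mem_iUnion.1 (hsub ⟨⟨F ⟨x, hx⟩, Set.mem_range_self _⟩, rfl⟩)
  refine eventually_atTop.2 ⟨k, fun j hj => ?_⟩
  obtain ⟨i, him, hxi⟩ := hU j _ (Set.mem_accumulate.2 ⟨k, hj, hk⟩)
  refine ⟨j + i, by omega, Nat.add_lt_add_left him j, ?_⟩
  obtain ⟨y, hyp, hy⟩ := hp j (j + i) ⟨x, hx⟩ (by rwa [Nat.add_sub_cancel_left])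
  rw [Nat.add_sub_cancel_left] at hy
  rw [← hyp]
  have hed : edist (F ⟨x, hx⟩) (F y) ≤ Metric.ediam (U j i) := by
    refine le_trans (le_of_eq ?_) (Metric.edist_le_ediam_of_mem hxi hy)
    rw [UniformSpace.Completion.edist_eq]
    rfl
  have hmul : ((j + i : ℕ) + 2 : ℝ≥0∞) * edist (F ⟨x, hx⟩) (F y) ≤ 1 := by
    calc ((j + i : ℕ) + 2 : ℝ≥0∞) * edist (F ⟨x, hx⟩) (F y)
        ≤ ((j + 2) * (i + 1)) * Metric.ediam (U j i) := by
          gcongr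
          norm_cast
          nlinarith
      _ = (j + 2) * ((i + 1) * Metric.ediam (U j i)) := mul_assoc _ _ _
      _ ≤ ((j : ℝ≥0∞) + 2) * ((j : ℝ≥0∞) + 2)⁻¹ := by gcongr; exact hUd j i him
      _ = 1 := ENNReal.mul_inv_cancel (by simp) (by finiteness)
  have hdist : ((j + i : ℕ) + 2 : ℝ) * dist (F ⟨x, hx⟩) (F y) ≤ 1 := by
    have := ENNReal.toReal_mono ENNReal.one_ne_top hmul
    rw [ENNReal.toReal_mul, ← dist_edist] at this
    simpa [ENNReal.toReal_add] using this
  set n := j + i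
  obtain ⟨l, hl⟩ : ∃ l, Nat.log 2 (n + 2) = l + 1 :=
    Nat.exists_eq_succ_of_ne_zero (Nat.log_pos one_lt_two (by omega)).ne'
  have hl1 : 2 ^ (l + 1) ≤ n + 2 := hl ▸ Nat.pow_log_le_self 2 (by omega)
  have hl2 : n + 2 < 2 ^ (l + 2) := by
    have := Nat.lt_pow_succ_log_self one_lt_two (n + 2)
    rwa [hl] at this
  have hle : dist (F ⟨x, hx⟩) (F y) ≤ (1 / 2) ^ (l + 1) := by
    rw [one_div, inv_pow, ← one_div, le_div_iff₀ (by positivity), mul_comm]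
    refine le_trans (mul_le_mul_of_nonneg_right ?_ dist_nonneg) hdist
    exact_mod_cast hl1
  intro t ht
  have := (hF ⟨x, hx⟩ y l).1 (dist_le_of_forall_lt.1 hle l (Nat.lt_succ_self l))
  exact this t (ht.trans_le ((hf₀ n).trans (hf (by omega))))

theorem IsGroupCovered.isUHNull {X : Set Cantor} (hX : IsGroupCovered X) : IsUHNull.{0, v} X := by
  intro Y _ f hf
  -- The exponent `n * n` beats every dimension `d > 0`: once `n * d ≥ 1`, the `d`-th power of the
  -- diameter is at most `2⁻¹ ^ n`, which is summable.
  have hmod : ∀ n : ℕ, ∃ h : ℕ, ∀ x y : X, (∀ i < h, (x : Cantor) i = (y : Cantor) i) →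
      dist (f x) (f y) ≤ (1 / 2) ^ (n * n) := by
    intro n
    obtain ⟨δ, hδ, h⟩ := Metric.uniformContinuous_iff.1 hf ((1 / 2) ^ (n * n)) (by positivity)
    obtain ⟨k, hk⟩ := exists_pow_lt_of_lt_one hδ (by norm_num : (1 / 2 : ℝ) < 1)
    exact ⟨k, fun x y hxy => (h (lt_of_le_of_lt
      ((dist_le_of_forall_lt (E := fun _ => ZMod 2)).2 hxy) hk)).le⟩
  choose h hh using hmod
  obtain ⟨g, p, hgp⟩ := hX h
  let Z := UniformSpace.Completion (Set.range f)
  have hXtb : TotallyBounded (Set.univ : Set X) := by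
    exact totallyBounded_preimage (isUniformInducing_val X) isCompact_univ.totallyBounded
  let : MeasurableSpace Z := borel Z
  have : BorelSpace Z := ⟨rfl⟩
  let ι : X → Z := fun x => ((⟨f x, Set.mem_range_self x⟩ : Set.range f) : Z)
  -- A uniformly continuous image of the totally bounded `X` has compact completion, so the closed
  -- sets `K m` below are compact.
  have : CompactSpace Z := by
    refine ⟨isCompact_iff_totallyBounded_isComplete.2 ⟨?_, isComplete_univ⟩⟩
    have hι : UniformContinuous ι :=
      (UniformSpace.Completion.uniformContinuous_coe _).comp (hf.subtype_mk _)
    have hcl := (hXtb.image hι).closure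
    have hrange : ι '' Set.univ = Set.range ((↑) : Set.range f → Z) := by
      ext z
      constructor
      · rintro ⟨x, -, rfl⟩
        exact ⟨_, rfl⟩
      · rintro ⟨⟨_, x, rfl⟩, rfl⟩
        exact ⟨x, trivial, rfl⟩
    rwa [hrange, UniformSpace.Completion.denseRange_coe.closure_range] at hcl
  let S : ℕ → ℕ → Set Z := fun j n => closure (ι '' {x | ∀ i < h n, (x : Cantor) i = p j n i})
  have hS : ∀ j n, Metric.ediam (S j n) ≤ 2⁻¹ ^ (n * n) := by
    intro j n
    rw [Metric.ediam_closure]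
    refine Metric.ediam_le ?_
    rintro _ ⟨x, hx, rfl⟩ _ ⟨y, hy, rfl⟩
    rw [UniformSpace.Completion.edist_eq]
    change edist (f x) (f y) ≤ _
    rw [edist_dist]
    refine (ENNReal.ofReal_le_ofReal (hh n x y fun i hi => (hx i hi).trans (hy i hi).symm)).trans ?_
    rw [ENNReal.ofReal_pow (by norm_num)]
    simp [ENNReal.ofReal_inv_of_pos]
  let K : ℕ → Set Z := fun m => ⋂ j ≥ m, ⋃ n ∈ Finset.Ico j (g j), S j n
  have hK : ∀ m, IsClosed (K m) := fun m => isClosed_biInter fun j _ =>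
    (Finset.Ico j (g j)).finite_toSet.isClosed_biUnion fun n _ => isClosed_closure
  have hdim : ∀ m, dimH (K m) ≤ 0 := by
    intro m
    refine dimH_le fun d hd => ?_
    by_contra hpos
    have hpos' : 0 < d := pos_iff_ne_zero.2 (by simpa using hpos)
    obtain ⟨M, hM⟩ := exists_nat_ge (1 / (d : ℝ))
    have hterm : ∀ j n, M ≤ n → Metric.ediam (S j n) ^ (d : ℝ) ≤ 2⁻¹ ^ n := by
      intro j n hn
      have hd1 : 1 ≤ n * (d : ℝ) := by
        rw [div_le_iff₀ (by exact_mod_cast hpos')] at hM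
        refine hM.trans ?_
        gcongr
      calc Metric.ediam (S j n) ^ (d : ℝ) ≤ (2⁻¹ ^ (n * n)) ^ (d : ℝ) := by gcongr; exact hS j n
        _ = 2⁻¹ ^ (n * (n * (d : ℝ))) := by
          rw [← ENNReal.rpow_natCast, ← ENNReal.rpow_mul]; push_cast; ring_nf
        _ ≤ 2⁻¹ ^ (n : ℝ) := by
          refine ENNReal.rpow_le_rpow_of_exponent_ge (by simp) ?_
          exact le_mul_of_one_le_right (Nat.cast_nonneg n) hd1
        _ = 2⁻¹ ^ n := ENNReal.rpow_natCast _ _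
    have hle := Measure.hausdorffMeasure_le_liminf_sum (l := atTop) (d : ℝ) (K m)
      (fun j : ℕ => (2⁻¹ : ℝ≥0∞) ^ j) (ENNReal.tendsto_pow_atTop_nhds_zero_of_lt_one (by simp))
      (fun j (n : Finset.Ico j (g j)) => S j n)
      (Eventually.of_forall fun j n => (hS j n).trans (pow_le_pow_right_of_le_one' (by simp)
        ((Finset.mem_Ico.1 n.2).1.trans (Nat.le_mul_self _))))
      ((eventually_ge_atTop m).mono fun j hj z hz => ?_)
    · have hfin : liminf (fun j => ∑ n : Finset.Ico j (g j), Metric.ediam (S j n) ^ (d : ℝ)) atTop ≤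
          ∑' n : ℕ, (2⁻¹ : ℝ≥0∞) ^ n := by
        refine liminf_le_of_frequently_le' (Eventually.frequently
          ((eventually_ge_atTop M).mono fun j hj => ?_))
        rw [Finset.sum_coe_sort (Finset.Ico j (g j)) fun n => Metric.ediam (S j n) ^ (d : ℝ)]
        refine (Finset.sum_le_sum fun n hn => hterm j n
          (hj.trans (Finset.mem_Ico.1 hn).1)).trans (ENNReal.sum_le_tsum _)
      refine (lt_of_le_of_lt (hle.trans hfin) ?_).ne hd
      simp
    · obtain ⟨n, hn, hzn⟩ := Set.mem_iUnion₂.1 (Set.mem_iInter₂.1 hz j hj)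
      exact Set.mem_iUnion.2 ⟨⟨n, hn⟩, hzn⟩
  refine le_antisymm (iInf_le_of_le (⋃ m, K m) (iInf_le_of_le
    (isSigmaCompact_iUnion_of_isCompact _ fun m => (hK m).isCompact)
    (iInf_le_of_le ?_ ?_))) bot_le
  · rintro _ ⟨⟨_, x, rfl⟩, rfl⟩
    obtain ⟨m, hm⟩ := eventually_atTop.1 (hgp x x.2)
    refine Set.mem_iUnion.2 ⟨m, Set.mem_iInter₂.2 fun j hj => ?_⟩
    obtain ⟨n, h₁, h₂, h₃⟩ := hm j hj
    exact Set.mem_iUnion₂.2 ⟨n, Finset.mem_Ico.2 ⟨h₁, h₂⟩, subset_closure ⟨x, h₃, rfl⟩⟩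
  · rw [dimH_iUnion]
    exact iSup_le hdim

end Cantor

theorem theorem8p2 (X : Set Cantor) :
    List.TFAE
      [IsUHNull.{0, v} X,
       Cantor.IsAdditive Cantor.meagerIdeal X,
       Cantor.IsAdditive Cantor.nullFsigmaIdeal X,
       Cantor.IsSharplyAdditive Cantor.meagerIdeal X,
       Cantor.IsSharplyAdditive Cantor.nullFsigmaIdeal X,
       Cantor.IsSharplyNull X] := by
  tfae_have 1 → 2 := fun h =>
    (Cantor.isGroupCovered_of_isUHNull h).isSharplyAdditive_meager.isAdditive_meager
  tfae_have 2 → 4 := fun h => h.isGroupCovered_of_meager.isSharplyAdditive_meager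
  tfae_have 4 → 6 := fun h => h.isSharplyNull
  tfae_have 6 → 5 := fun h => h.isGroupCovered.isSharplyAdditive_nullFsigma
  tfae_have 5 → 3 := fun h => h.isAdditive_nullFsigma
  tfae_have 3 → 1 := fun h => h.isGroupCovered_of_nullFsigma.isUHNull
  tfae_finish
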